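/- All logarithms are to base $2$. **Branching programs.** A non-deterministic branching program (NBP) $Z$ is a finite directed acyclic multigraph with exactly one source and exactly one sink, some of whose edges are labelled with literals of Boolean variables. A source-sink path is *computational* if no two opposite literals occur on it. $Z$ computes the Boolean function that is true on exactly those assignments which make true all the literals labelling the edges of some computational path. $Z$ is a (syntactic) *read-$d$-times* NBP, or $d$-NBP, if every variable occurs at most $d$ times on every source-sink path (computational or not). The size $|Z|$ is the number of vertices of $Z$. **Binary tree based graphs.** In a rooted tree, a leaf is a non-root vertex without children; the tree is binary if every vertex has at most two children, and *extended* if no leaf has a sibling. A *binary tree based graph* is a finite graph $H$ given as an edge-disjoint union of binary extended rooted trees $T_1,\dots,T_m$ with roots $t_1,\dots,t_m$ such that every vertex that is a leaf of some $T_i$ is a leaf of exactly two of the trees, any two of the trees have at most one common vertex, and such a common vertex is a leaf in both. Put $n=|V(H)|$. A *pseudoedge* is a pair $\{t_i,t_j\}$, $i\ne j$, such that $T_i$ and $T_j$ have a common leaf; $P_{i,j}$ is then the path from $t_i$ to $t_j$ in $T_i\cup T_j$. A *pseudomatching* is a set of pairwise disjoint pseudoedges; it is *between* disjoint sets $A,B$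 of roots if each of its pseudoedges has exactly one end in $A$ and exactly one end in $B$. **Pseudoexpanders.** $H$ is a *pseudoexpander* if (1) every root-leaf path of every $T_i$ has at most $(\log m)/4.9+3$ vertices, and (2) for any two disjoint sets $A,B$ of roots with $|A|,|B|\ge m^{0.999}$ there is a pseudomatching between $A$ and $B$ of size at least $m^{0.999}/3$. **The formula.** $\varphi_H$ is the monotone CNF whose variables are the vertices of $H$ and which has, for each pseudoedge $\{t_i,t_j\}$, the clause $C_{i,j}=\bigvee_{v\in V(P_{i,j})}v$. **Theorem.** There exist constants $\alpha>1$, $0<\beta<1$ and $N$ such that for every pseudoexpander $H$ with $n\ge N$ vertices, every integer $d\ge 0$ with $d\le \log n/10^5$, and every $d$-NBP $Z$ computing $\varphi_H$, $$|Z|\ \ge\ \alpha^{\,n^{\beta}}.$$ -/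

import Mathlib

/-! ### Literals and CNFs -/

/-- A literal over the variables `X`: `(x, true)` is the literal `x`, `(x, false)` is `¬ x`. -/
abbrev Literal (X : Type*) := X × Bool

/-- A clause, given by its set of literals. -/
abbrev Clause (X : Type*) := Set (Literal X)

/-- A CNF, given by its set of clauses. -/
abbrev CNF (X : Type*) := Set (Clause X)

/-- The truth assignment `a` satisfies `φ`: every clause has a literal that `a` makes true. -/
def CNF.Satisfies {X : Type*} (φ : CNF X) (a : X → Bool) : Prop :=
  ∀ C ∈ φ, ∃ l ∈ C, a l.1 = l.2

/-! ### Non-deterministic branching programs -/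

/-- A non-deterministic branching program over the variables `X`, with vertices `W` and edges `E`:
a directed acyclic multigraph with exactly one source and exactly one sink, some of whose edges
are labelled with literals. -/
structure NBP (X W E : Type*) where
  /-- tail of an edge -/
  src : E → W
  /-- head of an edge -/
  tgt : E → W
  /-- label of an edge; `none` if the edge is unlabelled -/
  label : E → Option (Literal X)
  acyclic : ∀ v, ¬ Relation.TransGen (fun a b => ∃ e, src e = a ∧ tgt e = b) v v
  source : W
  sink : W
  /-- `source` is the only vertex without incoming edges -/
  source_iff : ∀ v, (∀ e, tgt e ≠ v) ↔ v = source
  /-- `sink` is the only vertex without outgoing edges -/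
  sink_iff : ∀ v, (∀ e, src e ≠ v) ↔ v = sink

namespace NBP

variable {X W E : Type*}

/-- `Z.IsPath u P v`: the edges in the list `P` form a directed path from `u` to `v`
(by acyclicity no vertex repeats). -/
def IsPath (Z : NBP X W E) : W → List E → W → Prop
  | u, [], v => u = v
  | u, e :: P, v => Z.src e = u ∧ Z.IsPath (Z.tgt e) P v

/-- The list of the literals that label the edges of `P`, in order and with repetitions. -/
def labels (Z : NBP X W E) (P : List E) : List (Literal X) :=
  P.filterMap Z.label

/-- A computational path: a source-sink path on which no two opposite literals occur. -/
def IsComputational (Z : NBP X W E) (P : List E) : Prop :=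
  Z.IsPath Z.source P Z.sink ∧
    ∀ x, ¬ ((x, true) ∈ Z.labels P ∧ (x, false) ∈ Z.labels P)

/-- `Z` accepts the assignment `a` if `a` extends the assignment carried by some computational
path of `Z`. -/
def Accepts (Z : NBP X W E) (a : X → Bool) : Prop :=
  ∃ P, Z.IsComputational P ∧ ∀ l ∈ Z.labels P, a l.1 = l.2

/-- `Z` computes the Boolean function represented by the CNF `φ`. -/
def Computes (Z : NBP X W E) (φ : CNF X) : Prop :=
  ∀ a : X → Bool, Z.Accepts a ↔ φ.Satisfies a

/-- `Z` is a (syntactic) read-`d`-times program: every variable occurs at most `d` times on every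
source-sink path, whether computational or not. -/
def ReadTimes (Z : NBP X W E) (d : ℕ) : Prop :=
  ∀ P, Z.IsPath Z.source P Z.sink →
    ∀ x, ((Z.labels P).filter (fun l => @decide (l.1 = x) (Classical.dec _))).length ≤ d

/-- The size of a program is the number of its vertices. -/
def size [Fintype W] (_Z : NBP X W E) : ℕ := Fintype.card W

end NBP

/-! ### Rooted trees -/

/-- A rooted tree whose vertices belong to the finite set `V`, given by its vertex set, its root
and the parent map (whose values outside `verts` are irrelevant; the root is sent to itself). -/
structure RTree (V : Type*) where
  verts : Set V
  root : V
  parent : V → V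
  root_mem : root ∈ verts
  parent_root : parent root = root
  parent_mem : ∀ v ∈ verts, parent v ∈ verts
  /-- following parents from any vertex one arrives at the root -/
  exists_iterate : ∀ v ∈ verts, ∃ k : ℕ, parent^[k] v = root

namespace RTree

variable {V : Type*}

/-- The children of `p`. -/
def children (T : RTree V) (p : V) : Set V :=
  {v | v ∈ T.verts ∧ v ≠ T.root ∧ T.parent v = p}

/-- A leaf is a vertex other than the root that has no children. -/
def IsLeaf (T : RTree V) (v : V) : Prop :=
  v ∈ T.verts ∧ v ≠ T.root ∧ T.children v = ∅

/-- The tree is binary: every vertex has at most two children. -/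
def IsBinary (T : RTree V) : Prop :=
  ∀ p ∈ T.verts, (T.children p).ncard ≤ 2

/-- The tree is extended: no leaf has a sibling. -/
def IsExtended (T : RTree V) : Prop :=
  ∀ v, T.IsLeaf v → T.children (T.parent v) = {v}

/-- The set of vertices of the path of the tree that connects `v` with the root. -/
def rootPath (T : RTree V) (v : V) : Set V :=
  {u | ∃ k : ℕ, T.parent^[k] v = u}

/-- The edges of the tree, as an undirected graph on the ambient vertex set. -/
def toGraph (T : RTree V) : SimpleGraph V :=
  SimpleGraph.fromRel (fun u v => u ∈ T.verts ∧ T.parent u = v)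

end RTree

/-! ### Binary tree based graphs and pseudoexpanders -/

/-- A binary tree based graph with vertex set `V`, together with its trees `T_1, …, T_m`. -/
structure BTB (V : Type*) where
  graph : SimpleGraph V
  /-- the number of trees (equivalently, of roots) -/
  m : ℕ
  tree : Fin m → RTree V
  binary : ∀ i, (tree i).IsBinary
  extended : ∀ i, (tree i).IsExtended
  /-- the graph is the union of the trees ... -/
  verts_cover : ∀ v, ∃ i, v ∈ (tree i).verts
  graph_eq : graph = ⨆ i, (tree i).toGraph
  /-- ... and no edge belongs to two of them -/
  edge_disjoint : ∀ i j, i ≠ j → Disjoint (tree i).toGraph.edgeSet (tree j).toGraph.edgeSet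
  /-- every vertex that is a leaf of some tree is a leaf of exactly two trees -/
  leaf_two : ∀ v, (∃ i, (tree i).IsLeaf v) → {i | (tree i).IsLeaf v}.ncard = 2
  /-- two trees have at most one common vertex -/
  common_unique : ∀ i j, i ≠ j → ∀ u v, u ∈ (tree i).verts → u ∈ (tree j).verts →
    v ∈ (tree i).verts → v ∈ (tree j).verts → u = v
  /-- a common vertex of two trees is a leaf in both -/
  common_leaf : ∀ i j, i ≠ j → ∀ v, v ∈ (tree i).verts → v ∈ (tree j).verts →
    (tree i).IsLeaf v ∧ (tree j).IsLeaf v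

namespace BTB

variable {V : Type*}

/-- Distinct trees have distinct roots, so that roots may be identified with their indices. -/
theorem root_injective (H : BTB V) : Function.Injective fun i => (H.tree i).root := by
  intro i j h
  by_contra hij
  have hj : (H.tree i).root ∈ (H.tree j).verts := by
    have h' : (H.tree i).root = (H.tree j).root := h
    rw [h']
    exact (H.tree j).root_mem
  exact (H.common_leaf i j hij _ (H.tree i).root_mem hj).1.2.1 rfl

/-- The underlying graph `U(H)`: its vertices are the (indices of the) roots, and two roots are
adjacent, i.e. form a pseudoedge, if their trees have a common leaf. -/
def underlying (H : BTB V) : SimpleGraph (Fin H.m) where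
  Adj i j := i ≠ j ∧ ∃ v, (H.tree i).IsLeaf v ∧ (H.tree j).IsLeaf v
  symm := ⟨fun _ _ h => ⟨h.1.symm, h.2.imp fun _ hv => hv.symm⟩⟩
  loopless := ⟨fun _ h => h.1 rfl⟩

/-- A pseudomatching: a set of pseudoedges no two of which share an end. -/
def IsPseudomatching (H : BTB V) (M : Set (Sym2 (Fin H.m))) : Prop :=
  M ⊆ H.underlying.edgeSet ∧ ∀ e ∈ M, ∀ f ∈ M, ∀ i, i ∈ e → i ∈ f → e = f

/-- `M` is between `A` and `B`: each of its elements meets each of `A` and `B` in exactly one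
root. -/
def IsBetween (H : BTB V) (M : Set (Sym2 (Fin H.m))) (A B : Set (Fin H.m)) : Prop :=
  ∀ e ∈ M, (∃! i, i ∈ e ∧ i ∈ A) ∧ (∃! i, i ∈ e ∧ i ∈ B)

/-- Pseudoexpanders. The height of a tree is the largest number of vertices of a root-leaf path;
logarithms are binary. -/
structure IsPseudoexpander (H : BTB V) : Prop where
  small_height : ∀ i v, (H.tree i).IsLeaf v →
    (((H.tree i).rootPath v).ncard : ℝ) ≤ Real.logb 2 (H.m : ℝ) / 4.9 + 3
  large_pseudomatching : ∀ A B : Set (Fin H.m), Disjoint A B →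
    (H.m : ℝ) ^ (0.999 : ℝ) ≤ (A.ncard : ℝ) → (H.m : ℝ) ^ (0.999 : ℝ) ≤ (B.ncard : ℝ) →
    ∃ M : Set (Sym2 (Fin H.m)), H.IsPseudomatching M ∧ H.IsBetween M A B ∧
      (H.m : ℝ) ^ (0.999 : ℝ) / 3 ≤ (M.ncard : ℝ)

/-- The vertex set of `P_{i,j}`, the path that joins the roots of two adjacent trees through
their (unique) common leaf `v`: it consists of the two root-leaf paths that end in `v`. -/
def pathVerts (H : BTB V) (i j : Fin H.m) : Set V :=
  {u | ∃ v, (H.tree i).IsLeaf v ∧ (H.tree j).IsLeaf v ∧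
    (u ∈ (H.tree i).rootPath v ∨ u ∈ (H.tree j).rootPath v)}

/-- The clause `C_{i,j}`: the positive literals of the vertices of `P_{i,j}`. -/
def clause (H : BTB V) (i j : Fin H.m) : Clause V :=
  {l | l.1 ∈ H.pathVerts i j ∧ l.2 = true}

/-- The monotone CNF `φ_H`: its variables are the vertices of `H`, and it has the clause `C_{i,j}`
for each pseudoedge. -/
def phi (H : BTB V) : CNF V :=
  {C | ∃ i j, H.underlying.Adj i j ∧ C = H.clause i j}

end BTB

/-! The proof counts accepted assignments by the shape of their accepting paths. A leaf is chosen in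
each tree by `c` and a bit for each pair of roots by `b`. The inner vertices on chosen root-leaf
paths and all leaves are false; other inner vertices are true. If two trees choose their common
leaf, the pair is mutual and the bit makes exactly one of its two roots true; all other roots are
true. Every such assignment satisfies `φ_H` (`satisfies_assign`), and the clause of a mutual pair
rests on one root alone.

An accepting path is cut greedily into at most `(2 * d + 1) ^ 2` segments, each of which can read
only a `1 / (2 * (d + 1))` fraction of the `m` roots (`exists_segments_of_isPath`). The ends and
labels recorded for the segments form a signature, and a small program has few signatures.

For a fixed signature, each root can occur in at most `d` segments. An averaging argument
(`exists_splitting`) divides the segments into two classes such that many roots `A` are read only in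
the first and many roots `B` only in the second. The pseudoexpander gives a large pseudomatching `M`
between `A` and `B`. Two paths with the same signature can be mixed: one supplies the first class,
the other the second. If for the same `c` two choices of bits differed at a mutual pair of `M`, and
only at such pairs, mixing would falsify both roots of that pair and hence its clause
(`not_acceptsAlong_of_separated`). So a fraction of at most `2 ^ (-k)` of the bits is accepted when
`k` pairs of `M` are mutual.

A given pair is mutual with probability at least `1 / L ^ 2`, where `L = 2 ^ h` is about `m ^ (1 /
4.9)`, and disjoint pairs are independent (`sum_prod_half`). Each signature therefore accounts for a
fraction of at most `exp (-m ^ 0.999 / (6 * L ^ 2))` of the choices. Since `2 / 4.9 < 0.999`, a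
program of size below `exp (n ^ 0.01)` has too few signatures to cover them all. -/

/-! ### Depth in rooted trees -/

namespace RTree

variable {V : Type*}

theorem iterate_parent_mem (T : RTree V) {v : V} (hv : v ∈ T.verts) (k : ℕ) :
    T.parent^[k] v ∈ T.verts := by
  induction k with
  | zero => exact hv
  | succ k ih => rw [Function.iterate_succ_apply']; exact T.parent_mem _ ih

theorem iterate_parent_root (T : RTree V) (k : ℕ) : T.parent^[k] T.root = T.root :=
  Function.iterate_fixed T.parent_root k

theorem rootPath_subset (T : RTree V) {v : V} (hv : v ∈ T.verts) : T.rootPath v ⊆ T.verts := by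
  rintro u ⟨k, rfl⟩
  exact T.iterate_parent_mem hv k

theorem root_mem_rootPath (T : RTree V) {v : V} (hv : v ∈ T.verts) : T.root ∈ T.rootPath v :=
  T.exists_iterate v hv

/-- A leaf lies on the root path of no other vertex. -/
theorem IsLeaf.eq_of_iterate {T : RTree V} {v w : V} (hv : T.IsLeaf v) (hw : w ∈ T.verts) {k : ℕ}
    (h : T.parent^[k] w = v) : w = v := by
  cases k with
  | zero => exact h
  | succ k =>
    rw [Function.iterate_succ_apply'] at h
    have hmem : T.parent^[k] w ∈ T.children v := by
      refine ⟨T.iterate_parent_mem hw k, fun hr => hv.2.1 ?_, h⟩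
      rw [← h, hr, T.parent_root]
    rw [hv.2.2] at hmem
    exact hmem.elim

theorem IsLeaf.parent_not_isLeaf {T : RTree V} {v : V} (hv : T.IsLeaf v) :
    ¬ T.IsLeaf (T.parent v) := by
  intro hp
  have : v ∈ T.children (T.parent v) := ⟨hv.1, hv.2.1, rfl⟩
  rw [hp.2.2] at this
  exact this.elim

/-- In an extended tree the parent of a leaf determines the leaf. -/
theorem IsExtended.eq_of_parent_mem_rootPath {T : RTree V} (hT : T.IsExtended) {v w : V}
    (hv : T.IsLeaf v) (hw : T.IsLeaf w) (h : T.parent v ∈ T.rootPath w) : w = v := by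
  classical
  have hex : ∃ k : ℕ, T.parent^[k] w = T.parent v := h
  obtain ⟨k, hk⟩ : ∃ k, Nat.find hex = k := ⟨_, rfl⟩
  have hk1 : T.parent^[k] w = T.parent v := hk ▸ Nat.find_spec hex
  cases k with
  | zero => exact (hv.parent_not_isLeaf (hk1 ▸ hw)).elim
  | succ k =>
    -- The vertex just before the first visit to `T.parent v` is a child of it, hence is `v` because
    -- `v` has no sibling; and a leaf has no proper descendants.
    have hmin : T.parent^[k] w ≠ T.parent v := Nat.find_min hex (by omega)
    rw [Function.iterate_succ_apply'] at hk1
    have hmem : T.parent^[k] w ∈ T.children (T.parent v) := by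
      refine ⟨T.iterate_parent_mem hw.1 k, fun hr => hmin ?_, hk1⟩
      rw [← hk1, hr, T.parent_root]
    rw [hT v hv] at hmem
    exact hv.eq_of_iterate hw.1 hmem

open Classical in
/-- The distance of `v` from the root; `0` outside the tree. -/
noncomputable def depth (T : RTree V) (v : V) : ℕ :=
  if h : ∃ k : ℕ, T.parent^[k] v = T.root then Nat.find h else 0

theorem iterate_depth (T : RTree V) {v : V} (hv : v ∈ T.verts) :
    T.parent^[T.depth v] v = T.root := by
  classical
  have h := T.exists_iterate v hv
  rw [depth, dif_pos h]
  exact Nat.find_spec h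

theorem depth_le (T : RTree V) {v : V} {k : ℕ} (h : T.parent^[k] v = T.root) : T.depth v ≤ k := by
  classical
  rw [depth, dif_pos ⟨k, h⟩]
  exact Nat.find_min' _ h

theorem depth_eq_zero (T : RTree V) {v : V} (hv : v ∈ T.verts) : T.depth v = 0 ↔ v = T.root := by
  refine ⟨fun h => ?_, fun h => Nat.le_zero.1 (T.depth_le h)⟩
  have := T.iterate_depth hv
  rwa [h] at this

theorem depth_eq_parent_add_one (T : RTree V) {v : V} (hv : v ∈ T.verts) (hr : v ≠ T.root) :
    T.depth v = T.depth (T.parent v) + 1 := by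
  apply le_antisymm
  · apply T.depth_le
    rw [Function.iterate_succ_apply]
    exact T.iterate_depth (T.parent_mem v hv)
  · have h0 : T.depth v ≠ 0 := fun h => hr ((T.depth_eq_zero hv).1 h)
    obtain ⟨k, hk⟩ := Nat.exists_eq_succ_of_ne_zero h0
    rw [hk]
    refine Nat.succ_le_succ (T.depth_le ?_)
    have := T.iterate_depth hv
    rwa [hk, Function.iterate_succ_apply] at this

theorem depth_iterate_le (T : RTree V) {v : V} (hv : v ∈ T.verts) (k : ℕ) :
    T.depth (T.parent^[k] v) ≤ T.depth v := by
  apply T.depth_le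
  rw [← Function.iterate_add_apply, Nat.add_comm, Function.iterate_add_apply, T.iterate_depth hv,
    T.iterate_parent_root]

theorem depth_lt_ncard_rootPath [Finite V] (T : RTree V) {v : V} (hv : v ∈ T.verts) :
    T.depth v + 1 ≤ (T.rootPath v).ncard := by
  classical
  have hinj : Set.InjOn (fun k => T.parent^[k] v) (Finset.range (T.depth v + 1) : Set ℕ) := by
    have key : ∀ a b, a < b → b ≤ T.depth v → T.parent^[a] v ≠ T.parent^[b] v := by
      intro a b hab hb h
      have h1 : T.parent^[T.depth v - b + a] v = T.root := by
        rw [Function.iterate_add_apply, h, ← Function.iterate_add_apply, Nat.sub_add_cancel hb]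
        exact T.iterate_depth hv
      have := T.depth_le h1
      omega
    intro a ha b hb h
    simp only [Finset.coe_range, Set.mem_Iio] at ha hb
    rcases lt_trichotomy a b with hab | hab | hab
    · exact (key a b hab (by omega) h).elim
    · exact hab
    · exact (key b a hab (by omega) h.symm).elim
  rw [← Finset.card_range (T.depth v + 1), ← Finset.card_image_of_injOn hinj,
    ← Set.ncard_coe_finset]
  apply Set.ncard_le_ncard _ (Set.toFinite _)
  intro u hu
  simp only [Finset.coe_image, Set.mem_image] at hu
  obtain ⟨k, -, rfl⟩ := hu
  exact ⟨k, rfl⟩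

/-- A deepest descendant of `v` has no children. -/
theorem exists_leaf_depth_le [Finite V] (T : RTree V) {v : V} (hv : v ∈ T.verts)
    (hr : v ≠ T.root) : ∃ w, T.IsLeaf w ∧ T.depth v ≤ T.depth w := by
  obtain ⟨w, ⟨hw, k, hk⟩, hmax⟩ := Set.exists_max_image
    {w | w ∈ T.verts ∧ ∃ k : ℕ, T.parent^[k] w = v} T.depth (Set.toFinite _) ⟨v, hv, 0, rfl⟩
  refine ⟨w, ⟨hw, ?_, ?_⟩, hk ▸ T.depth_iterate_le hw k⟩
  · rintro rfl
    exact hr (by rw [← hk, T.iterate_parent_root])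
  · rw [Set.eq_empty_iff_forall_notMem]
    rintro u ⟨hu, hur, rfl⟩
    have h1 := hmax u ⟨hu, k + 1, by rw [Function.iterate_succ_apply]; exact hk⟩
    have h2 := T.depth_eq_parent_add_one hu hur
    omega

/-- A binary tree has at most `2 ^ k` vertices at distance `k` from the root. -/
theorem IsBinary.ncard_depth_eq_le [Finite V] {T : RTree V} (hT : T.IsBinary) (k : ℕ) :
    {v | v ∈ T.verts ∧ T.depth v = k}.ncard ≤ 2 ^ k := by
  classical
  have := Fintype.ofFinite V
  induction k with
  | zero =>
    rw [pow_zero]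
    refine (Set.ncard_le_ncard (t := {T.root}) ?_ (Set.toFinite _)).trans
      (Set.ncard_singleton _).le
    rintro v ⟨hv, h0⟩
    exact (T.depth_eq_zero hv).1 h0
  | succ k ih =>
    rw [Set.ncard_eq_toFinset_card'] at ih ⊢
    rw [pow_succ, mul_comm]
    refine (Finset.card_le_mul_card_image_of_maps_to (f := T.parent)
      (t := {v | v ∈ T.verts ∧ T.depth v = k}.toFinset) ?_ 2 ?_).trans (by gcongr)
    · intro v hv
      simp only [Set.mem_toFinset, Set.mem_ofPred_eq] at hv ⊢
      have hr : v ≠ T.root := fun h => by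
        have := (T.depth_eq_zero hv.1).2 h
        omega
      have := T.depth_eq_parent_add_one hv.1 hr
      exact ⟨T.parent_mem v hv.1, by omega⟩
    · intro p hp
      simp only [Set.mem_toFinset, Set.mem_ofPred_eq] at hp
      refine le_trans ?_ (hT p hp.1)
      rw [← Set.ncard_coe_finset]
      apply Set.ncard_le_ncard _ (Set.toFinite _)
      intro v hv
      simp only [Finset.coe_filter, Set.mem_toFinset, Set.mem_ofPred_eq] at hv
      refine ⟨hv.1.1, fun h => ?_, hv.2⟩
      have := (T.depth_eq_zero hv.1.1).2 h
      omega

/-- A binary tree all of whose root-leaf paths have at most `h` vertices has less than `2 ^ h`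
vertices. -/
theorem IsBinary.ncard_verts_lt [Finite V] {T : RTree V} (hT : T.IsBinary) {h : ℕ} (h0 : 0 < h)
    (hh : ∀ v, T.IsLeaf v → (T.rootPath v).ncard ≤ h) : T.verts.ncard < 2 ^ h := by
  classical
  have hsub : T.verts ⊆ ⋃ k ∈ Finset.range h, {v | v ∈ T.verts ∧ T.depth v = k} := by
    intro v hv
    simp only [Finset.mem_range, Set.mem_iUnion, Set.mem_ofPred_eq, exists_prop]
    refine ⟨T.depth v, ?_, hv, rfl⟩
    -- A tree consisting of its root alone has no leaf to bound its depth; this is where `0 < h` is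
    -- needed.
    by_cases hr : v = T.root
    · rwa [(T.depth_eq_zero hv).2 hr]
    · obtain ⟨w, hw, hle⟩ := T.exists_leaf_depth_le hv hr
      have h1 := T.depth_lt_ncard_rootPath hw.1
      have h2 := hh w hw
      omega
  calc T.verts.ncard ≤ _ := Set.ncard_le_ncard hsub (Set.toFinite _)
    _ ≤ ∑ k ∈ Finset.range h, {v | v ∈ T.verts ∧ T.depth v = k}.ncard :=
        Finset.set_ncard_biUnion_le _ _
    _ ≤ ∑ k ∈ Finset.range h, 2 ^ k := Finset.sum_le_sum fun k _ => hT.ncard_depth_eq_le k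
    _ < 2 ^ h := Nat.geomSum_lt (le_refl 2) fun k hk => Finset.mem_range.1 hk

end RTree

/-! ### Assignments that satisfy `φ_H` -/

namespace BTB

variable {V : Type*} {L : ℕ}

/-- The vertex count of a binary tree based graph whose root-leaf paths have at most `h`
vertices. -/
theorem card_le [Fintype V] (H : BTB V) {h : ℕ} (h0 : 0 < h)
    (hh : ∀ i v, (H.tree i).IsLeaf v → ((H.tree i).rootPath v).ncard ≤ h) :
    Fintype.card V ≤ H.m * 2 ^ h := by
  classical
  have hsub : (Set.univ : Set V) ⊆ ⋃ i ∈ (Finset.univ : Finset (Fin H.m)), (H.tree i).verts := by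
    intro v _
    simpa using H.verts_cover v
  calc Fintype.card V = (Set.univ : Set V).ncard := by
        rw [Set.ncard_univ, Nat.card_eq_fintype_card]
    _ ≤ _ := Set.ncard_le_ncard hsub (Set.toFinite _)
    _ ≤ ∑ i : Fin H.m, (H.tree i).verts.ncard := Finset.set_ncard_biUnion_le _ _
    _ ≤ ∑ _i : Fin H.m, 2 ^ h :=
        Finset.sum_le_sum fun i _ => ((H.binary i).ncard_verts_lt h0 (hh i)).le
    _ = H.m * 2 ^ h := by simp

/-- The leaves of each tree are numbered, injectively, by `Fin L`. -/
def IsNumbering (H : BTB V) (idx : Fin H.m → V → Fin L) : Prop :=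
  ∀ i, Set.InjOn (idx i) {v | (H.tree i).IsLeaf v}

/-- One index set for all trees makes the choices `c` a product space with independent uniform
coordinates. Numbers carried by no leaf are harmless: they select nothing. -/
theorem exists_isNumbering [Finite V] (H : BTB V) {h : ℕ} (h0 : 0 < h)
    (hh : ∀ i v, (H.tree i).IsLeaf v → ((H.tree i).rootPath v).ncard ≤ h) :
    ∃ idx : Fin H.m → V → Fin (2 ^ h), H.IsNumbering idx := by
  classical
  have := Fintype.ofFinite V
  have key : ∀ i, ∃ f : V → Fin (2 ^ h), Set.InjOn f {v | (H.tree i).IsLeaf v} := by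
    intro i
    have hcard : Fintype.card {v // (H.tree i).IsLeaf v} ≤ Fintype.card (Fin (2 ^ h)) := by
      rw [Fintype.card_fin]
      refine le_trans ?_ ((H.binary i).ncard_verts_lt h0 (hh i)).le
      rw [← Nat.card_eq_fintype_card]
      exact Set.ncard_le_ncard (s := {v | (H.tree i).IsLeaf v}) (fun v hv => hv.1)
        (Set.toFinite _)
    obtain ⟨g⟩ := Function.Embedding.nonempty_of_card_le hcard
    refine ⟨fun v => if hv : (H.tree i).IsLeaf v then g ⟨v, hv⟩ else ⟨0, by positivity⟩, ?_⟩
    intro v hv w hw hvw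
    simp only [Set.mem_ofPred_eq] at hv hw
    simp only [dif_pos hv, dif_pos hw] at hvw
    simpa using g.injective hvw
  choose idx hidx using key
  exact ⟨idx, hidx⟩

/-- The choice `c` selects the leaf `v` in the tree `i`. -/
def Selects (H : BTB V) (idx : Fin H.m → V → Fin L) (c : Fin H.m → Fin L) (i : Fin H.m)
    (v : V) : Prop :=
  (H.tree i).IsLeaf v ∧ idx i v = c i

/-- The choice `c` selects in the trees `i` and `j` their common leaf. -/
def Mutual (H : BTB V) (idx : Fin H.m → V → Fin L) (c : Fin H.m → Fin L) (i j : Fin H.m) :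
    Prop :=
  i ≠ j ∧ ∃ v, H.Selects idx c i v ∧ H.Selects idx c j v

/-- The vertices that are made true by the choice `c` of leaves and the choice `b` of one end of
each pair of roots: an inner vertex is true if it does not lie on the path to the selected leaf,
a leaf is false, and of the two roots of a mutual pair exactly one is true, as told by `b`; the
other roots are true. -/
def TrueAt (H : BTB V) (idx : Fin H.m → V → Fin L) (c : Fin H.m → Fin L)
    (b : Sym2 (Fin H.m) → Bool) (v : V) : Prop :=
  (∃ i, v = (H.tree i).root ∧ ∀ j, H.Mutual idx c i j → b s(i, j) = decide (i < j)) ∨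
  ((∀ i, v ≠ (H.tree i).root) ∧ (∀ i, ¬ (H.tree i).IsLeaf v) ∧
    ∀ i w, H.Selects idx c i w → v ∉ (H.tree i).rootPath w)

open Classical in
/-- The assignment given by `TrueAt`. -/
noncomputable def assign (H : BTB V) (idx : Fin H.m → V → Fin L) (c : Fin H.m → Fin L)
    (b : Sym2 (Fin H.m) → Bool) (v : V) : Bool :=
  decide (H.TrueAt idx c b v)

theorem assign_eq_true (H : BTB V) (idx : Fin H.m → V → Fin L) (c : Fin H.m → Fin L)
    (b : Sym2 (Fin H.m) → Bool) (v : V) : H.assign idx c b v = true ↔ H.TrueAt idx c b v := by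
  simp [assign]

variable {H : BTB V} {idx : Fin H.m → V → Fin L} {c : Fin H.m → Fin L}
  {b : Sym2 (Fin H.m) → Bool}

theorem Mutual.symm {i j : Fin H.m} (h : H.Mutual idx c i j) : H.Mutual idx c j i :=
  ⟨h.1.symm, h.2.imp fun _ hv => hv.symm⟩

theorem Mutual.adj {i j : Fin H.m} (h : H.Mutual idx c i j) : H.underlying.Adj i j :=
  ⟨h.1, h.2.imp fun _ hv => ⟨hv.1.1, hv.2.1⟩⟩

theorem eq_of_mem_verts_of_not_isLeaf {i k : Fin H.m} {v : V} (hi : v ∈ (H.tree i).verts)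
    (hv : ¬ (H.tree i).IsLeaf v) (hk : v ∈ (H.tree k).verts) : k = i := by
  by_contra hne
  exact hv (H.common_leaf k i hne v hk hi).2

theorem eq_of_isLeaf {i j k : Fin H.m} {v : V} (hi : (H.tree i).IsLeaf v)
    (hj : (H.tree j).IsLeaf v) (hk : (H.tree k).IsLeaf v) (hij : i ≠ j) (hik : i ≠ k) :
    k = j := by
  have h2 := H.leaf_two v ⟨i, hi⟩
  obtain ⟨x, y, hxy, he⟩ := Set.ncard_eq_two.1 h2
  have hi' : i ∈ ({x, y} : Set _) := he ▸ hi
  have hj' : j ∈ ({x, y} : Set _) := he ▸ hj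
  have hk' : k ∈ ({x, y} : Set _) := he ▸ hk
  simp only [Set.mem_insert_iff, Set.mem_singleton_iff] at hi' hj' hk'
  grind

/-- Mutual pairs are pairwise disjoint, so the bits of different mutual pairs control different
roots. -/
theorem Mutual.unique (hidx : H.IsNumbering idx) {i j k : Fin H.m} (hj : H.Mutual idx c i j)
    (hk : H.Mutual idx c i k) : k = j := by
  obtain ⟨hij, v, hvi, hvj⟩ := hj
  obtain ⟨hik, w, hwi, hwk⟩ := hk
  have hvw : w = v := hidx i hwi.1 hvi.1 (hwi.2.trans hvi.2.symm)
  subst hvw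
  exact eq_of_isLeaf hvi.1 hvj.1 hwk.1 hij hik

theorem trueAt_root_iff {i : Fin H.m} : H.TrueAt idx c b (H.tree i).root ↔
    ∀ j, H.Mutual idx c i j → b s(i, j) = decide (i < j) := by
  constructor
  · rintro (⟨k, hk, h⟩ | ⟨h, -⟩)
    · obtain rfl := H.root_injective hk
      exact h
    · exact (h i rfl).elim
  · exact fun h => Or.inl ⟨i, rfl, h⟩

theorem Mutual.trueAt_root_iff (hidx : H.IsNumbering idx) {i j : Fin H.m}
    (h : H.Mutual idx c i j) :
    H.TrueAt idx c b (H.tree i).root ↔ b s(i, j) = decide (i < j) := by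
  rw [BTB.trueAt_root_iff]
  refine ⟨fun h' => h' j h, fun hb k hk => ?_⟩
  rwa [h.unique hidx hk]

/-- A tree in which the leaf `v` is not selected has a true vertex on the path to `v`. -/
theorem exists_trueAt_of_not_selects {i : Fin H.m} {v : V} (hv : (H.tree i).IsLeaf v)
    (hs : ¬ H.Selects idx c i v) : ∃ u ∈ (H.tree i).rootPath v, H.TrueAt idx c b u := by
  have hp : ∀ w, H.Selects idx c i w → (H.tree i).parent v ∉ (H.tree i).rootPath w := by
    intro w hw hmem
    exact hs ((H.extended i).eq_of_parent_mem_rootPath hv hw.1 hmem ▸ hw)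
  have hpm := (H.tree i).parent_mem v hv.1
  -- The witness is the parent of `v`: since `v` has no sibling, the path to any other leaf avoids
  -- it. If it is the root, nothing is selected in this tree, so the root has no mutual partner and
  -- is true.
  refine ⟨(H.tree i).parent v, ⟨1, rfl⟩, ?_⟩
  by_cases hr : (H.tree i).parent v = (H.tree i).root
  · rw [hr, BTB.trueAt_root_iff]
    rintro j ⟨-, w, hw, -⟩
    exact (hp w hw (hr ▸ (H.tree i).root_mem_rootPath hw.1.1)).elim
  · refine Or.inr ⟨fun k hk => ?_, fun k hk => ?_, fun k w hw hmem => ?_⟩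
    · obtain rfl := eq_of_mem_verts_of_not_isLeaf hpm hv.parent_not_isLeaf
        (hk ▸ (H.tree k).root_mem)
      exact hr hk
    · obtain rfl := eq_of_mem_verts_of_not_isLeaf hpm hv.parent_not_isLeaf hk.1
      exact hv.parent_not_isLeaf hk
    · obtain rfl := eq_of_mem_verts_of_not_isLeaf hpm hv.parent_not_isLeaf
        ((H.tree k).rootPath_subset hw.1.1 hmem)
      exact hp w hw hmem

/-- If one of the two trees does not select the common leaf, its half of the clause contains a true
vertex; otherwise the pair is mutual and the bit makes one root true. `decide (i < j)` orients the
unordered pair, so swapping `i` and `j` negates the condition. -/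
theorem satisfies_assign (hidx : H.IsNumbering idx) : H.phi.Satisfies (H.assign idx c b) := by
  rintro C ⟨i, j, ⟨hij, v, hvi, hvj⟩, rfl⟩
  suffices h : ∃ u, (u ∈ (H.tree i).rootPath v ∨ u ∈ (H.tree j).rootPath v) ∧
      H.TrueAt idx c b u by
    obtain ⟨u, hu, ht⟩ := h
    exact ⟨(u, true), ⟨⟨v, hvi, hvj, hu⟩, rfl⟩, (H.assign_eq_true idx c b u).2 ht⟩
  by_cases hsi : H.Selects idx c i v
  · by_cases hsj : H.Selects idx c j v
    · have hm : H.Mutual idx c i j := ⟨hij, v, hsi, hsj⟩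
      by_cases hb : b s(i, j) = decide (i < j)
      · exact ⟨_, Or.inl ((H.tree i).root_mem_rootPath hvi.1), (hm.trueAt_root_iff hidx).2 hb⟩
      · refine ⟨_, Or.inr ((H.tree j).root_mem_rootPath hvj.1),
          (hm.symm.trueAt_root_iff hidx).2 ?_⟩
        rw [Sym2.eq_swap]
        rcases lt_or_gt_of_ne hij with h | h <;> simp_all [h.not_gt]
    · obtain ⟨u, hu, ht⟩ := exists_trueAt_of_not_selects (b := b) hvj hsj
      exact ⟨u, Or.inr hu, ht⟩
  · obtain ⟨u, hu, ht⟩ := exists_trueAt_of_not_selects (b := b) hvi hsi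
    exact ⟨u, Or.inl hu, ht⟩

theorem not_trueAt_of_mem_rootPath {i : Fin H.m} {u v : V} (hv : H.Selects idx c i v)
    (hu : u ∈ (H.tree i).rootPath v) (hr : u ≠ (H.tree i).root) : ¬ H.TrueAt idx c b u := by
  rintro (⟨k, rfl, -⟩ | ⟨-, -, h⟩)
  · by_cases hk : k = i
    · exact hr (hk ▸ rfl)
    · exact (H.common_leaf k i hk _ (H.tree k).root_mem
        ((H.tree i).rootPath_subset hv.1.1 hu)).1.2.1 rfl
  · exact h i v hv hu

/-- The clause of a mutual pair contains no true vertex but the two roots. -/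
theorem Mutual.eq_root_of_trueAt {i j : Fin H.m} (h : H.Mutual idx c i j) {u : V}
    (hu : u ∈ H.pathVerts i j) (ht : H.TrueAt idx c b u) :
    u = (H.tree i).root ∨ u = (H.tree j).root := by
  obtain ⟨hij, v, hvi, hvj⟩ := h
  obtain ⟨w, hwi, hwj, hw⟩ := hu
  obtain rfl := H.common_unique i j hij w v hwi.1 hwj.1 hvi.1.1 hvj.1.1
  by_contra hne
  rw [not_or] at hne
  rcases hw with hw | hw
  · exact not_trueAt_of_mem_rootPath hvi hw hne.1 ht
  · exact not_trueAt_of_mem_rootPath hvj hw hne.2 ht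

end BTB

/-! ### Cutting the paths of a branching program into segments -/

namespace NBP

variable {X W E : Type*}

theorem isPath_append (Z : NBP X W E) {P Q : List E} {u v : W} :
    Z.IsPath u (P ++ Q) v ↔ ∃ w, Z.IsPath u P w ∧ Z.IsPath w Q v := by
  induction P generalizing u with
  | nil => simp [IsPath]
  | cons e P ih => simp [IsPath, ih, and_assoc]

theorem labels_append (Z : NBP X W E) (P Q : List E) :
    Z.labels (P ++ Q) = Z.labels P ++ Z.labels Q :=
  List.filterMap_append

theorem transGen_of_isPath (Z : NBP X W E) {P : List E} {u v : W} (h : Z.IsPath u P v)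
    (hP : P ≠ []) : Relation.TransGen (fun a b => ∃ e, Z.src e = a ∧ Z.tgt e = b) u v := by
  induction P generalizing u with
  | nil => exact (hP rfl).elim
  | cons e P ih =>
    obtain ⟨h1, h2⟩ := h
    by_cases hP' : P = []
    · subst hP'
      exact .single ⟨e, h1, h2⟩
    · exact .head ⟨e, h1, rfl⟩ (ih h2 hP')

theorem eq_nil_of_isPath_self (Z : NBP X W E) {P : List E} {u : W} (h : Z.IsPath u P u) :
    P = [] := by
  by_contra hP
  exact Z.acyclic u (Z.transGen_of_isPath h hP)

/-- A segment of a path: its two ends and, if the segment is a single edge whose label is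
prescribed, that label. -/
abbrev Segment (X W : Type*) := W × W × Option (Option (Literal X))

/-- The path `Q` realizes the segment `s`. -/
def Realizes (Z : NBP X W E) (s : Segment X W) (Q : List E) : Prop :=
  Z.IsPath s.1 Q s.2.1 ∧ ∀ l, s.2.2 = some l → ∃ e, Q = [e] ∧ Z.label e = l

/-- The variables that occur on some realization of the segment `s`. -/
def segVars (Z : NBP X W E) (s : Segment X W) : Set X :=
  {x | ∃ Q, Z.Realizes s Q ∧ ∃ l ∈ Z.labels Q, l.1 = x}

/-- The number of variables of `Y` that occur on some realization of the segment `s`. -/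
noncomputable def load (Z : NBP X W E) (Y : Finset X) (s : Segment X W) : ℕ :=
  open Classical in (Y.filter (· ∈ Z.segVars s)).card

/-- Consecutive segments from `u` to `v`. -/
def SegmentChain : W → List (Segment X W) → W → Prop
  | u, [], v => u = v
  | u, s :: ss, v => s.1 = u ∧ SegmentChain s.2.1 ss v

variable {Z : NBP X W E}

theorem SegmentChain.isPath_flatten {segs : List (Segment X W)} {Qs : List (List E)} {u v : W}
    (hc : SegmentChain u segs v) (hr : List.Forall₂ Z.Realizes segs Qs) :
    Z.IsPath u Qs.flatten v := by
  induction hr generalizing u with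
  | nil => exact hc
  | cons h _ ih =>
    obtain ⟨h1, h2⟩ := hc
    rw [List.flatten_cons, isPath_append]
    exact ⟨_, h1 ▸ h.1, ih h2⟩

open Classical in
/-- Realizations can be chosen so that `x` occurs in every segment where this is possible. -/
theorem exists_realization_countP_le (x : X) {segs : List (Segment X W)} {Qs : List (List E)}
    (hr : List.Forall₂ Z.Realizes segs Qs) :
    ∃ Rs : List (List E), List.Forall₂ Z.Realizes segs Rs ∧
      segs.countP (fun s => x ∈ Z.segVars s) ≤
        ((Z.labels Rs.flatten).filter (fun l => l.1 = x)).length := by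
  induction hr with
  | nil => exact ⟨[], .nil, by simp⟩
  | @cons s Q segs Qs h _ ih =>
    obtain ⟨Rs, hRs, hle⟩ := ih
    by_cases hx : x ∈ Z.segVars s
    · obtain ⟨R, hR, l, hl, hlx⟩ := id hx
      refine ⟨R :: Rs, .cons hR hRs, ?_⟩
      rw [List.countP_cons, List.flatten_cons, labels_append, List.filter_append,
        List.length_append]
      have : 0 < ((Z.labels R).filter (fun l => l.1 = x)).length := by
        apply List.length_pos_of_mem (a := l)
        simp [hl, hlx]
      simp only [hx, decide_true, if_true]
      omega
    · refine ⟨Q :: Rs, .cons h hRs, ?_⟩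
      rw [List.countP_cons, List.flatten_cons, labels_append, List.filter_append,
        List.length_append]
      simp only [hx, decide_false, Bool.false_eq_true, if_false]
      omega

-- This is where the bound must be syntactic: realizations that read `x` wherever possible are
-- concatenated into a source-sink path which need not be computational.
open Classical in
theorem ReadTimes.countP_le {d : ℕ} (hZ : Z.ReadTimes d) {segs : List (Segment X W)}
    {Qs : List (List E)} (hc : SegmentChain Z.source segs Z.sink)
    (hr : List.Forall₂ Z.Realizes segs Qs) (x : X) :
    segs.countP (fun s => x ∈ Z.segVars s) ≤ d := by
  obtain ⟨Rs, hRs, hle⟩ := exists_realization_countP_le x hr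
  refine hle.trans ((le_of_eq ?_).trans (hZ _ (hc.isPath_flatten hRs) x))
  congr!

open Classical in
theorem sum_load (Y : Finset X) (segs : List (Segment X W)) :
    (segs.map (Z.load Y)).sum = ∑ x ∈ Y, segs.countP (fun s => x ∈ Z.segVars s) := by
  induction segs with
  | nil => simp
  | cons s segs ih =>
    simp only [List.map_cons, List.sum_cons, List.countP_cons, Finset.sum_add_distrib, ih,
      load, Finset.card_filter, decide_eq_true_eq]
    omega

theorem ReadTimes.sum_load_le {d : ℕ} (hZ : Z.ReadTimes d) (Y : Finset X)
    {segs : List (Segment X W)} {Qs : List (List E)}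
    (hc : SegmentChain Z.source segs Z.sink) (hr : List.Forall₂ Z.Realizes segs Qs) :
    (segs.map (Z.load Y)).sum ≤ d * Y.card := by
  classical
  rw [sum_load, mul_comm, ← smul_eq_mul, ← Finset.sum_const]
  exact Finset.sum_le_sum fun x _ => hZ.countP_le hc hr x

theorem load_self (Y : Finset X) (u : W) : Z.load Y (u, u, none) = 0 := by
  classical
  rw [load, Finset.card_eq_zero, Finset.filter_eq_empty_iff]
  rintro x - ⟨Q, ⟨hQ, -⟩, l, hl, -⟩
  rw [Z.eq_nil_of_isPath_self hQ] at hl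
  simp [labels] at hl

/-- The label is part of the segment because parallel edges may carry different variables; with the
ends alone the load would be unbounded. -/
theorem load_some_le (Y : Finset X) (u v : W) (l : Option (Literal X)) :
    Z.load Y (u, v, some l) ≤ 1 := by
  classical
  rw [load, Finset.card_le_one]
  have key : ∀ x, x ∈ Z.segVars (u, v, some l) → ∃ k, l = some k ∧ k.1 = x := by
    rintro x ⟨Q, ⟨-, hQ⟩, k, hk, hkx⟩
    obtain ⟨e, rfl, he⟩ := hQ l rfl
    refine ⟨k, ?_, hkx⟩
    simp only [labels, List.mem_filterMap, List.mem_singleton, exists_eq_left] at hk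
    rw [← he, hk]
  intro x hx y hy
  obtain ⟨k, hk, rfl⟩ := key x (Finset.mem_filter.1 hx).2
  obtain ⟨k', hk', rfl⟩ := key y (Finset.mem_filter.1 hy).2
  rw [hk] at hk'
  rw [Option.some.inj hk']

/-- On a path of load more than `t` there is an edge at which the load passes `t`. -/
theorem exists_edge_load_gt (Y : Finset X) (t : ℕ) {P : List E} {u v : W} (hP : Z.IsPath u P v)
    (ht : t < Z.load Y (u, v, none)) :
    ∃ Q e R, P = Q ++ e :: R ∧ Z.load Y (u, Z.src e, none) ≤ t ∧
      t < Z.load Y (u, Z.tgt e, none) := by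
  induction P using List.reverseRecOn generalizing v with
  | nil =>
    obtain rfl : u = v := hP
    rw [load_self] at ht
    omega
  | append_singleton P e ih =>
    obtain ⟨w, hP', rfl, rfl⟩ := Z.isPath_append.1 hP
    by_cases h : Z.load Y (u, Z.src e, none) ≤ t
    · exact ⟨P, e, [], rfl, h, ht⟩
    · obtain ⟨Q, e', R, rfl, h1, h2⟩ := ih hP' (by omega)
      exact ⟨Q, e', R ++ [e], by simp, h1, h2⟩

/-- A path can be cut greedily into `2 * k + 1` segments of small load, where `k * (t + 1)` is at
most the total load of some other chain of segments. -/
theorem exists_segments_of_isPath (Y : Finset X) (t : ℕ) (P : List E) (u v : W)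
    (hP : Z.IsPath u P v) :
    ∃ (segs coarse : List (Segment X W)) (Qs Rs : List (List E)) (k : ℕ),
      SegmentChain u segs v ∧ List.Forall₂ Z.Realizes segs Qs ∧ Qs.flatten = P ∧
      (∀ s ∈ segs, Z.load Y s ≤ max t 1) ∧ segs.length ≤ 2 * k + 1 ∧
      SegmentChain u coarse v ∧ List.Forall₂ Z.Realizes coarse Rs ∧
      k * (t + 1) ≤ (coarse.map (Z.load Y)).sum := by
  induction hn : P.length using Nat.strong_induction_on generalizing P u with
  | _ n ih =>
    by_cases ht : Z.load Y (u, v, none) ≤ t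
    · have hr : List.Forall₂ Z.Realizes [(u, v, none)] [P] := .cons ⟨hP, by simp⟩ .nil
      refine ⟨[(u, v, none)], [(u, v, none)], [P], [P], 0, ⟨rfl, rfl⟩, hr, by simp, ?_, by simp,
        ⟨rfl, rfl⟩, hr, by simp⟩
      intro s hs
      rw [List.mem_singleton] at hs
      subst hs
      exact ht.trans (le_max_left _ _)
    · obtain ⟨Q, e, R, rfl, h1, h2⟩ := exists_edge_load_gt Y t hP (not_le.1 ht)
      obtain ⟨w, hQ, he, hR⟩ := Z.isPath_append.1 hP
      subst he
      obtain ⟨segs, coarse, Qs, Rs, k, hc, hr, hf, hl, hlen, hc', hr', hk⟩ :=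
        ih R.length (by simp at hn; omega) R (Z.tgt e) hR rfl
      -- The critical edge becomes a segment of its own, of load at most `1`; hence `max t 1` and
      -- two new segments per cut. In the coarse chain it is merged with the part before it, giving
      -- a segment of load at least `t + 1`.
      refine ⟨(u, Z.src e, none) :: (Z.src e, Z.tgt e, some (Z.label e)) :: segs,
        (u, Z.tgt e, none) :: coarse, Q :: [e] :: Qs, (Q ++ [e]) :: Rs, k + 1,
        ⟨rfl, rfl, hc⟩, ?_, by simp [hf], ?_, by simp; omega, ⟨rfl, hc'⟩, ?_, ?_⟩
      · refine .cons ⟨hQ, by simp⟩ (.cons ⟨⟨rfl, rfl⟩, ?_⟩ hr)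
        rintro l hl
        exact ⟨e, rfl, Option.some.inj hl⟩
      · intro s hs
        rcases List.mem_cons.1 hs with rfl | hs
        · exact h1.trans (le_max_left _ _)
        rcases List.mem_cons.1 hs with rfl | hs
        · exact (load_some_le _ _ _ _).trans (le_max_right _ _)
        · exact hl s hs
      · refine .cons ⟨?_, by simp⟩ hr'
        exact Z.isPath_append.2 ⟨_, hQ, rfl, rfl⟩
      · rw [List.map_cons, List.sum_cons, add_mul, one_mul]
        omega

/-- The accepted assignment `a` has an accepting path that is cut into the given segments. -/
def AcceptsAlong (Z : NBP X W E) (segs : List (Segment X W)) (a : X → Bool) : Prop :=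
  SegmentChain Z.source segs Z.sink ∧ ∃ Qs, List.Forall₂ Z.Realizes segs Qs ∧
    ∀ l ∈ Z.labels Qs.flatten, a l.1 = l.2

theorem ReadTimes.exists_acceptsAlong {d : ℕ} (hZ : Z.ReadTimes d) (Y : Finset X) (t : ℕ)
    {a : X → Bool} (ha : Z.Accepts a) :
    ∃ segs, Z.AcceptsAlong segs a ∧ (∀ s ∈ segs, Z.load Y s ≤ max t 1) ∧
      ∃ k, segs.length ≤ 2 * k + 1 ∧ k * (t + 1) ≤ d * Y.card := by
  obtain ⟨P, ⟨hP, -⟩, hPa⟩ := ha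
  obtain ⟨segs, coarse, Qs, Rs, k, hc, hr, hf, hl, hlen, hc', hr', hk⟩ :=
    exists_segments_of_isPath Y t P _ _ hP
  subst hf
  exact ⟨segs, ⟨hc, Qs, hr, hPa⟩, hl, k, hlen, hk.trans (hZ.sum_load_le Y hc' hr')⟩

/-- Two realizations of the same segments can be mixed. -/
theorem exists_mixed_realization (S : Set (Segment X W)) {segs : List (Segment X W)}
    {Qs Rs : List (List E)} (hQ : List.Forall₂ Z.Realizes segs Qs)
    (hR : List.Forall₂ Z.Realizes segs Rs) :
    ∃ Ms, List.Forall₂ Z.Realizes segs Ms ∧ ∀ l ∈ Z.labels Ms.flatten,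
      (l ∈ Z.labels Rs.flatten ∧ ∃ s ∈ segs, s ∈ S ∧ l.1 ∈ Z.segVars s) ∨
      (l ∈ Z.labels Qs.flatten ∧ ∃ s ∈ segs, s ∉ S ∧ l.1 ∈ Z.segVars s) := by
  classical
  induction hQ generalizing Rs with
  | nil => exact ⟨[], .nil, by simp [labels]⟩
  | @cons s Q segs Qs h _ ih =>
    obtain ⟨R, Rs, h', hRs, rfl⟩ := List.forall₂_cons_left_iff.1 hR
    obtain ⟨Ms, hMs, hl⟩ := ih hRs
    refine ⟨(if s ∈ S then R else Q) :: Ms, .cons (by split_ifs <;> assumption) hMs, ?_⟩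
    intro l hlm
    rw [List.flatten_cons, labels_append, List.mem_append] at hlm
    simp only [List.flatten_cons, labels_append, List.mem_append, List.mem_cons]
    rcases hlm with hlm | hlm
    · by_cases hs : s ∈ S
      · rw [if_pos hs] at hlm
        exact Or.inl ⟨Or.inl hlm, s, Or.inl rfl, hs, R, h', l, hlm, rfl⟩
      · rw [if_neg hs] at hlm
        exact Or.inr ⟨Or.inl hlm, s, Or.inl rfl, hs, Q, h, l, hlm, rfl⟩
    · rcases hl l hlm with ⟨h1, r, hr, h2⟩ | ⟨h1, r, hr, h2⟩
      · exact Or.inl ⟨Or.inr h1, r, Or.inr hr, h2⟩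
      · exact Or.inr ⟨Or.inr h1, r, Or.inr hr, h2⟩

open Classical in
/-- If the variables of `A` occur only in segments of `S`, those of `B` only in other segments,
and `a` and `a'` differ only on `A ∪ B`, then the values of `a` on `A` may be replaced by those
of `a'`. -/
theorem AcceptsAlong.accepts_piecewise {segs : List (Segment X W)} {a a' : X → Bool}
    (ha : Z.AcceptsAlong segs a) (ha' : Z.AcceptsAlong segs a') (S : Set (Segment X W))
    {A B : Set X} (hA : ∀ x ∈ A, ∀ s ∈ segs, s ∉ S → x ∉ Z.segVars s)
    (hB : ∀ x ∈ B, ∀ s ∈ segs, s ∈ S → x ∉ Z.segVars s)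
    (hAB : ∀ x, x ∉ A → x ∉ B → a x = a' x) : Z.Accepts (A.piecewise a' a) := by
  obtain ⟨hc, Qs, hQ, hQa⟩ := ha
  obtain ⟨-, Rs, hR, hRa⟩ := ha'
  obtain ⟨Ms, hMs, hl⟩ := exists_mixed_realization S hQ hR
  have key : ∀ l ∈ Z.labels Ms.flatten, A.piecewise a' a l.1 = l.2 := by
    intro l hlm
    rcases hl l hlm with ⟨h, s, hs, hsS, hx⟩ | ⟨h, s, hs, hsS, hx⟩
    · by_cases hlA : l.1 ∈ A
      · rw [Set.piecewise_eq_of_mem _ _ _ hlA]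
        exact hRa l h
      · rw [Set.piecewise_eq_of_notMem _ _ _ hlA,
          hAB l.1 hlA fun hlB => hB _ hlB s hs hsS hx]
        exact hRa l h
    · rw [Set.piecewise_eq_of_notMem _ _ _ fun hlA => hA _ hlA s hs hsS hx]
      exact hQa l h
  -- Agreement with a single assignment also excludes opposite literals, so the mixed path is
  -- computational.
  refine ⟨Ms.flatten, ⟨hc.isPath_flatten hMs, ?_⟩, key⟩
  rintro x ⟨h1, h2⟩
  have h3 := key _ h1
  have h4 := key _ h2
  simp_all

end NBP

/-! ### Counting -/

/-- If each of the sets `O i` has at most `d` elements and each element lies in few of them, then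
some `S` contains many of the sets and is disjoint from many of them. -/
theorem exists_splitting {ι σ : Type*} [Fintype ι] [DecidableEq σ] (U : Finset σ)
    (O : ι → Finset σ) (d t : ℕ) (hOU : ∀ i, O i ⊆ U) (hO : ∀ i, (O i).card ≤ d)
    (ht : ∀ s ∈ U, (Finset.univ.filter fun i => s ∈ O i).card ≤ t)
    (hdt : 2 * (d * t) ≤ Fintype.card ι) :
    ∃ (S : Finset σ) (A B : Finset ι), (∀ i ∈ A, O i ⊆ S) ∧ (∀ i ∈ B, Disjoint (O i) S) ∧
      Fintype.card ι ≤ 2 * 4 ^ d * A.card ∧ Fintype.card ι ≤ 2 * 4 ^ d * B.card := by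
  classical
  set m := Fintype.card ι with hm
  rcases Nat.eq_zero_or_pos m with h0 | hpos
  · exact ⟨∅, ∅, ∅, by simp, by simp, by omega, by omega⟩
  let D : Finset (ι × ι) := Finset.univ.filter fun p => Disjoint (O p.1) (O p.2)
  -- `O i` has at most `d` elements, each in at most `t` sets, so it meets at most `d * t ≤ m / 2`
  -- of the sets.
  have hrow : ∀ i, m ≤ 2 * (Finset.univ.filter fun j => Disjoint (O i) (O j)).card := by
    intro i
    have h1 : (Finset.univ.filter fun j => ¬ Disjoint (O i) (O j)).card ≤ d * t := by
      have hsub : (Finset.univ.filter fun j => ¬ Disjoint (O i) (O j)) ⊆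
          (O i).biUnion fun s => Finset.univ.filter fun j => s ∈ O j := by
        intro j hj
        obtain ⟨s, hs, hs'⟩ := Finset.not_disjoint_iff.1 (Finset.mem_filter.1 hj).2
        simp only [Finset.mem_biUnion, Finset.mem_filter, Finset.mem_univ, true_and]
        exact ⟨s, hs, hs'⟩
      refine (Finset.card_le_card hsub).trans ((Finset.card_biUnion_le_card_mul _ _ t ?_).trans ?_)
      · exact fun s hs => ht s (hOU i hs)
      · exact Nat.mul_le_mul_right t (hO i)
    have h2 := Finset.card_filter_add_card_filter_not (s := (Finset.univ : Finset ι))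
      (fun j => Disjoint (O i) (O j))
    rw [Finset.card_univ] at h2
    omega
  have hD : m * m ≤ 2 * D.card := by
    have hDc : D.card = ∑ i, (Finset.univ.filter fun j => Disjoint (O i) (O j)).card := by
      simp only [D, Finset.card_filter]
      rw [Fintype.sum_prod_type]
    rw [hDc, Finset.mul_sum]
    calc m * m = ∑ _i : ι, m := by simp [hm]
      _ ≤ _ := Finset.sum_le_sum fun i _ => hrow i
  -- A uniformly random `S ⊆ U` contains one set of a disjoint pair and avoids the other with
  -- probability at least `4 ^ (-d)`, since at most `2 * d` memberships are prescribed.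
  have hpair : ∀ p ∈ D, 2 ^ U.card ≤ 4 ^ d *
      (U.powerset.filter fun S => O p.1 ⊆ S ∧ Disjoint (O p.2) S).card := by
    intro p hp
    have hdis := (Finset.mem_filter.1 hp).2
    have hcard : (U \ (O p.1 ∪ O p.2)).powerset.card ≤
        (U.powerset.filter fun S => O p.1 ⊆ S ∧ Disjoint (O p.2) S).card := by
      refine Finset.card_le_card_of_injOn (fun R => O p.1 ∪ R) ?_ ?_
      · intro R hR
        have hR' := Finset.mem_powerset.1 (Finset.mem_coe.1 hR)
        simp only [Finset.coe_filter, Finset.mem_powerset, Set.mem_ofPred_eq]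
        refine ⟨Finset.union_subset (hOU _) (hR'.trans Finset.sdiff_subset),
          Finset.subset_union_left, ?_⟩
        rw [Finset.disjoint_union_right]
        refine ⟨hdis.symm, ?_⟩
        rw [Finset.disjoint_left]
        intro s hs hsR
        have := Finset.mem_sdiff.1 (hR' hsR)
        exact this.2 (Finset.mem_union_right _ hs)
      · intro R hR R' hR' h
        have h1 := Finset.mem_powerset.1 (Finset.mem_coe.1 hR)
        have h2 := Finset.mem_powerset.1 (Finset.mem_coe.1 hR')
        ext s
        have h3 : s ∈ O p.1 ∪ R ↔ s ∈ O p.1 ∪ R' := by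
          have h' : O p.1 ∪ R = O p.1 ∪ R' := h
          rw [h']
        simp only [Finset.mem_union] at h3
        have h4 : s ∈ R → s ∉ O p.1 := fun hs ho =>
          (Finset.mem_sdiff.1 (h1 hs)).2 (Finset.mem_union_left _ ho)
        have h5 : s ∈ R' → s ∉ O p.1 := fun hs ho =>
          (Finset.mem_sdiff.1 (h2 hs)).2 (Finset.mem_union_left _ ho)
        tauto
    have hle : U.card ≤ 2 * d + (U \ (O p.1 ∪ O p.2)).card := by
      have h1 := Finset.card_union_le (O p.1) (O p.2)
      have h2 := Finset.le_card_sdiff (O p.1 ∪ O p.2) U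
      have h3 := hO p.1
      have h4 := hO p.2
      omega
    calc 2 ^ U.card ≤ 2 ^ (2 * d + (U \ (O p.1 ∪ O p.2)).card) :=
          Nat.pow_le_pow_right (by norm_num) hle
      _ = 4 ^ d * (U \ (O p.1 ∪ O p.2)).powerset.card := by
          rw [pow_add, pow_mul, Finset.card_powerset]
          norm_num
      _ ≤ _ := Nat.mul_le_mul_left _ hcard
  let A : Finset σ → Finset ι := fun S => Finset.univ.filter fun i => O i ⊆ S
  let B : Finset σ → Finset ι := fun S => Finset.univ.filter fun i => Disjoint (O i) S
  have hsum : ∑ p ∈ D, (U.powerset.filter fun S => O p.1 ⊆ S ∧ Disjoint (O p.2) S).card ≤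
      ∑ S ∈ U.powerset, (A S).card * (B S).card := by
    simp only [Finset.card_filter]
    rw [Finset.sum_comm]
    refine Finset.sum_le_sum fun S _ => ?_
    rw [← Finset.card_filter, ← Finset.card_product]
    refine Finset.card_le_card fun p hp => ?_
    have := (Finset.mem_filter.1 hp).2
    simp only [A, B, Finset.mem_product, Finset.mem_filter, Finset.mem_univ, true_and]
    exact this
  have htot : ∑ _S ∈ U.powerset, m * m ≤
      ∑ S ∈ U.powerset, 2 * 4 ^ d * ((A S).card * (B S).card) := by
    calc ∑ _S ∈ U.powerset, m * m = 2 ^ U.card * (m * m) := by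
          rw [Finset.sum_const, Finset.card_powerset, smul_eq_mul]
      _ ≤ 2 ^ U.card * (2 * D.card) := Nat.mul_le_mul_left _ hD
      _ = 2 * ∑ _p ∈ D, 2 ^ U.card := by rw [Finset.sum_const, smul_eq_mul]; ring
      _ ≤ 2 * ∑ p ∈ D, 4 ^ d *
            (U.powerset.filter fun S => O p.1 ⊆ S ∧ Disjoint (O p.2) S).card :=
          Nat.mul_le_mul_left _ (Finset.sum_le_sum hpair)
      _ = 2 * 4 ^ d *
            ∑ p ∈ D, (U.powerset.filter fun S => O p.1 ⊆ S ∧ Disjoint (O p.2) S).card := by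
          rw [← Finset.mul_sum, mul_assoc]
      _ ≤ 2 * 4 ^ d * ∑ S ∈ U.powerset, (A S).card * (B S).card := Nat.mul_le_mul_left _ hsum
      _ = _ := Finset.mul_sum _ _ _
  -- Some `S` reaches the average, so `m ^ 2 ≤ 2 * 4 ^ d * (|A| * |B|)`; as neither factor exceeds
  -- `m`, both are large.
  obtain ⟨S, -, hS⟩ := Finset.exists_le_of_sum_le ⟨∅, Finset.empty_mem_powerset U⟩ htot
  have hA : (A S).card ≤ m := Finset.card_le_univ _
  have hB : (B S).card ≤ m := Finset.card_le_univ _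
  refine ⟨S, A S, B S, fun i hi => (Finset.mem_filter.1 hi).2,
    fun i hi => (Finset.mem_filter.1 hi).2, ?_, ?_⟩
  · refine Nat.le_of_mul_le_mul_right (hS.trans ?_) hpos
    rw [← mul_assoc]
    exact Nat.mul_le_mul_left _ hB
  · refine Nat.le_of_mul_le_mul_right (hS.trans ?_) hpos
    rw [mul_comm (A S).card, ← mul_assoc]
    exact Nat.mul_le_mul_left _ hA

/-- A set of Boolean functions whose members are determined by their values outside `M`. -/
theorem card_mul_two_pow_le {ι : Type*} [Fintype ι] [DecidableEq ι] (G : Finset (ι → Bool))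
    (M : Finset ι) (h : ∀ b ∈ G, ∀ b' ∈ G, (∀ i, i ∉ M → b i = b' i) → b = b') :
    G.card * 2 ^ M.card ≤ 2 ^ Fintype.card ι := by
  have h1 : G.card ≤ 2 ^ (Mᶜ).card := by
    have : G.card ≤ (Finset.univ : Finset ({i // i ∈ Mᶜ} → Bool)).card := by
      refine Finset.card_le_card_of_injOn (fun b i => b i) (by simp) ?_
      intro b hb b' hb' hbb
      refine h b hb b' hb' fun i hi => ?_
      exact congrFun hbb ⟨i, Finset.mem_compl.2 hi⟩
    rwa [Finset.card_univ, Fintype.card_fun, Fintype.card_bool, Fintype.card_coe] at this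
  calc G.card * 2 ^ M.card ≤ 2 ^ (Mᶜ).card * 2 ^ M.card := Nat.mul_le_mul_right _ h1
    _ = 2 ^ Fintype.card ι := by rw [← pow_add, Finset.card_compl_add_card]

/-- Exchanging `x` with the coordinate `ω i` is an involution on the pairs `(ω, x)`. -/
theorem sum_sum_update {ι α : Type*} [Fintype ι] [DecidableEq ι] [Fintype α]
    (F : (ι → α) → ℝ) (i : ι) :
    ∑ ω : ι → α, ∑ x : α, F (Function.update ω i x) = Fintype.card α * ∑ ω, F ω := by
  classical
  have h1 : ∑ ω : ι → α, ∑ x : α, F (Function.update ω i x) = ∑ ω : ι → α, ∑ _x : α, F ω := by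
    rw [← Fintype.sum_prod_type', ← Fintype.sum_prod_type']
    refine Finset.sum_nbij' (fun p => (Function.update p.1 i p.2, p.1 i))
      (fun p => (Function.update p.1 i p.2, p.1 i)) ?_ ?_ ?_ ?_ ?_ <;> simp
  rw [h1]
  simp [Finset.mul_sum]

/-- Averages over two coordinates on which `F` does not depend. -/
theorem sum_mul_eq_of_update {ι α : Type*} [Fintype ι] [DecidableEq ι] [Fintype α]
    (F : (ι → α) → ℝ) (g : α → α → ℝ) {i j : ι} (hij : i ≠ j)
    (hi : ∀ ω x, F (Function.update ω i x) = F ω) (hj : ∀ ω x, F (Function.update ω j x) = F ω) :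
    (Fintype.card α : ℝ) ^ 2 * ∑ ω : ι → α, F ω * g (ω i) (ω j) =
      (∑ x, ∑ y, g x y) * ∑ ω : ι → α, F ω := by
  rw [pow_two, mul_assoc, ← sum_sum_update _ j, ← sum_sum_update _ i, Finset.mul_sum]
  refine Finset.sum_congr rfl fun ω _ => ?_
  rw [Finset.sum_mul]
  refine Finset.sum_congr rfl fun x _ => ?_
  rw [Finset.sum_mul]
  refine Finset.sum_congr rfl fun y _ => ?_
  rw [hj, hi, Function.update_of_ne hij, Function.update_self, Function.update_self]
  ring

/-- The expected value of `2 ^ (- k)`, where `k` is the number of the pairs of coordinates, out of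
a disjoint family, that take prescribed values. -/
theorem sum_prod_half {ι ε : Type*} [Fintype ι] [DecidableEq ι] {L : ℕ} (hL : 0 < L)
    (M : Finset ε) (i j : ε → ι) (x y : ε → Fin L) (hij : ∀ e ∈ M, i e ≠ j e)
    (hM : ∀ e ∈ M, ∀ f ∈ M, e ≠ f → i e ≠ i f ∧ i e ≠ j f ∧ j e ≠ i f ∧ j e ≠ j f) :
    ∑ ω : ι → Fin L, ∏ e ∈ M, (if ω (i e) = x e ∧ ω (j e) = y e then (1 / 2 : ℝ) else 1) =
      (L : ℝ) ^ Fintype.card ι * (1 - 1 / (2 * (L : ℝ) ^ 2)) ^ M.card := by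
  classical
  induction M using Finset.induction_on with
  | empty => simp
  | @insert e M he ih =>
    have hL' : (L : ℝ) ≠ 0 := by positivity
    have ih' := ih (fun f hf => hij f (Finset.mem_insert_of_mem hf))
      (fun f hf f' hf' => hM f (Finset.mem_insert_of_mem hf) f' (Finset.mem_insert_of_mem hf'))
    have hne : ∀ f ∈ M, i f ≠ i e ∧ j f ≠ i e ∧ i f ≠ j e ∧ j f ≠ j e := by
      intro f hf
      have := hM f (Finset.mem_insert_of_mem hf) e (Finset.mem_insert_self _ _)
        (fun h => he (h ▸ hf))
      exact ⟨this.1, this.2.2.1, this.2.1, this.2.2.2⟩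
    have key := sum_mul_eq_of_update
      (fun ω : ι → Fin L =>
        ∏ e ∈ M, (if ω (i e) = x e ∧ ω (j e) = y e then (1 / 2 : ℝ) else 1))
      (fun a b => if a = x e ∧ b = y e then (1 / 2 : ℝ) else 1)
      (hij e (Finset.mem_insert_self _ _))
      (fun ω z => Finset.prod_congr rfl fun f hf => by
        rw [Function.update_of_ne (hne f hf).1, Function.update_of_ne (hne f hf).2.1])
      (fun ω z => Finset.prod_congr rfl fun f hf => by
        rw [Function.update_of_ne (hne f hf).2.2.1, Function.update_of_ne (hne f hf).2.2.2])
    -- Exactly one of the `L ^ 2` pairs of values contributes `1 / 2` instead of `1`.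
    have hg : ∑ a : Fin L, ∑ b : Fin L, (if a = x e ∧ b = y e then (1 / 2 : ℝ) else 1) =
        (L : ℝ) ^ 2 - 1 / 2 := by
      have h1 : ∀ a b : Fin L, (if a = x e ∧ b = y e then (1 / 2 : ℝ) else 1) =
          1 - (if a = x e then (if b = y e then (1 / 2 : ℝ) else 0) else 0) := by
        intro a b
        by_cases ha : a = x e <;> by_cases hb : b = y e <;> norm_num [ha, hb]
      simp only [h1, Finset.sum_sub_distrib]
      simp [pow_two]
    rw [hg, ih', Fintype.card_fin] at key
    have hprod : ∀ ω : ι → Fin L,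
        ∏ f ∈ insert e M, (if ω (i f) = x f ∧ ω (j f) = y f then (1 / 2 : ℝ) else 1) =
        (∏ f ∈ M, (if ω (i f) = x f ∧ ω (j f) = y f then (1 / 2 : ℝ) else 1)) *
          (if ω (i e) = x e ∧ ω (j e) = y e then (1 / 2 : ℝ) else 1) := by
      intro ω
      rw [Finset.prod_insert he, mul_comm]
    simp only [hprod]
    rw [Finset.card_insert_of_notMem he, pow_succ]
    apply mul_left_cancel₀ (pow_ne_zero 2 hL')
    rw [key]
    field_simp

namespace BTB

variable {V : Type*}

/-- The functions `i` and `j` orient each pseudoedge from `A` to `B`; their values outside `M` are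
arbitrary. -/
theorem IsPseudoexpander.exists_pseudomatching {H : BTB V} (hH : H.IsPseudoexpander)
    (A B : Finset (Fin H.m)) (hAB : Disjoint A B) (hA : (H.m : ℝ) ^ (0.999 : ℝ) ≤ A.card)
    (hB : (H.m : ℝ) ^ (0.999 : ℝ) ≤ B.card) :
    ∃ (M : Finset (Sym2 (Fin H.m))) (i j : Sym2 (Fin H.m) → Fin H.m),
      (∀ e ∈ M, e = s(i e, j e) ∧ i e ∈ A ∧ j e ∈ B ∧ H.underlying.Adj (i e) (j e)) ∧
      (∀ e ∈ M, ∀ f ∈ M, e ≠ f → i e ≠ i f ∧ i e ≠ j f ∧ j e ≠ i f ∧ j e ≠ j f) ∧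
      (H.m : ℝ) ^ (0.999 : ℝ) / 3 ≤ M.card := by
  classical
  obtain ⟨M, ⟨hMe, hMd⟩, hMb, hMc⟩ := hH.large_pseudomatching A B
    (Finset.disjoint_coe.2 hAB) (by rwa [Set.ncard_coe_finset]) (by rwa [Set.ncard_coe_finset])
  have key : ∀ e : Sym2 (Fin H.m), ∃ p : Fin H.m × Fin H.m, e ∈ M →
      e = s(p.1, p.2) ∧ p.1 ∈ A ∧ p.2 ∈ B ∧ H.underlying.Adj p.1 p.2 := by
    intro e
    by_cases he : e ∈ M
    · obtain ⟨⟨i, ⟨hie, hiA⟩, -⟩, ⟨j, ⟨hje, hjB⟩, -⟩⟩ := hMb e he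
      have hij : i ≠ j := fun h =>
        Finset.disjoint_left.1 hAB (Finset.mem_coe.1 hiA) (h ▸ Finset.mem_coe.1 hjB)
      have hes : e = s(i, j) := ((Sym2.mem_and_mem_iff hij).1 ⟨hie, hje⟩)
      refine ⟨(i, j), fun _ => ⟨hes, hiA, hjB, ?_⟩⟩
      have := hMe he
      rwa [hes, SimpleGraph.mem_edgeSet] at this
    · by_cases hm : Nonempty (Fin H.m × Fin H.m)
      · exact ⟨hm.some, fun h => (he h).elim⟩
      · induction e with
        | _ a b => exact (hm ⟨(a, b)⟩).elim
  choose p hp using key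
  refine ⟨(Set.toFinite M).toFinset, fun e => (p e).1, fun e => (p e).2, ?_, ?_, ?_⟩
  · intro e he
    exact hp e ((Set.Finite.mem_toFinset _).1 he)
  · intro e he f hf hef
    rw [Set.Finite.mem_toFinset] at he hf
    have hmem : ∀ e ∈ M, (p e).1 ∈ e ∧ (p e).2 ∈ e := by
      intro e he
      have h := (hp e he).1
      generalize p e = q at h
      subst h
      simp
    obtain ⟨h1, h2⟩ := hmem e he
    obtain ⟨h3, h4⟩ := hmem f hf
    change (p e).1 ≠ (p f).1 ∧ (p e).1 ≠ (p f).2 ∧ (p e).2 ≠ (p f).1 ∧ (p e).2 ≠ (p f).2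
    exact ⟨fun h => hef (hMd e he f hf _ h1 (h ▸ h3)), fun h => hef (hMd e he f hf _ h1 (h ▸ h4)),
      fun h => hef (hMd e he f hf _ h2 (h ▸ h3)), fun h => hef (hMd e he f hf _ h2 (h ▸ h4))⟩
  · rwa [← Set.ncard_eq_toFinset_card]

end BTB

/-! ### The lower bound -/

namespace BTB

variable {V W E : Type*} {L : ℕ} {H : BTB V} {idx : Fin H.m → V → Fin L}

/-- Two assignments given by the same choice of leaves that are accepted along the same segments
cannot make false opposite ends of a mutual pair whose roots are separated by the segments. -/
theorem not_acceptsAlong_of_separated {Z : NBP V W E} (hZ : Z.Computes H.phi)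
    {segs : List (NBP.Segment V W)} {S : Set (NBP.Segment V W)} {A B : Finset (Fin H.m)}
    (hAB : Disjoint A B)
    (hA : ∀ i ∈ A, ∀ s ∈ segs, s ∉ S → (H.tree i).root ∉ Z.segVars s)
    (hB : ∀ i ∈ B, ∀ s ∈ segs, s ∈ S → (H.tree i).root ∉ Z.segVars s)
    {c : Fin H.m → Fin L} {b b' : Sym2 (Fin H.m) → Bool}
    (hbb : ∀ i j, i ∉ A → i ∉ B → b s(i, j) = b' s(i, j))
    {i j : Fin H.m} (hi : i ∈ A) (hj : j ∈ B) (hm : H.Mutual idx c i j)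
    (hib : ¬ H.TrueAt idx c b' (H.tree i).root) (hjb : ¬ H.TrueAt idx c b (H.tree j).root)
    (ha : Z.AcceptsAlong segs (H.assign idx c b)) :
    ¬ Z.AcceptsAlong segs (H.assign idx c b') := by
  classical
  intro ha'
  have hacc := ha.accepts_piecewise ha' S (A := (fun i => (H.tree i).root) '' (A : Set _))
    (B := (fun i => (H.tree i).root) '' (B : Set _))
    (by rintro _ ⟨k, hk, rfl⟩; exact hA k hk) (by rintro _ ⟨k, hk, rfl⟩; exact hB k hk)
    (by
      -- With the same `c`, the two assignments can differ only at roots, and there only through the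
      -- bits.
      intro v hvA hvB
      rw [Bool.eq_iff_iff, assign_eq_true, assign_eq_true]
      by_cases hr : ∃ k, v = (H.tree k).root
      · obtain ⟨k, rfl⟩ := hr
        rw [trueAt_root_iff, trueAt_root_iff]
        have hk : ∀ l, b s(k, l) = b' s(k, l) := fun l =>
          hbb k l (fun h => hvA ⟨k, h, rfl⟩) (fun h => hvB ⟨k, h, rfl⟩)
        simp only [hk]
      · rw [TrueAt, TrueAt]
        refine or_congr ?_ Iff.rfl
        exact ⟨fun ⟨k, hk, _⟩ => (hr ⟨k, hk⟩).elim, fun ⟨k, hk, _⟩ => (hr ⟨k, hk⟩).elim⟩)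
  obtain ⟨⟨u, _⟩, ⟨hu, rfl⟩, htrue⟩ := (hZ _).1 hacc _ ⟨i, j, hm.adj, rfl⟩
  have hjA : (H.tree j).root ∉ (fun i => (H.tree i).root) '' (A : Set _) := by
    rintro ⟨k, hk, hkj⟩
    obtain rfl := H.root_injective hkj
    exact Finset.disjoint_left.1 hAB hk hj
  simp only at hu htrue
  by_cases huA : u ∈ (fun i => (H.tree i).root) '' (A : Set _)
  · rw [Set.piecewise_eq_of_mem _ _ _ huA, assign_eq_true] at htrue
    rcases hm.eq_root_of_trueAt hu htrue with rfl | rfl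
    · exact hib htrue
    · exact hjA huA
  · rw [Set.piecewise_eq_of_notMem _ _ _ huA, assign_eq_true] at htrue
    rcases hm.eq_root_of_trueAt hu htrue with rfl | rfl
    · exact huA ⟨i, hi, rfl⟩
    · exact hjb htrue

open Classical in
/-- Few of the assignments given by choices are accepted along segments that separate the ends of
a large pseudomatching. -/
theorem card_acceptsAlong_le (hidx : H.IsNumbering idx) (hL : 0 < L) {Z : NBP V W E}
    (hZ : Z.Computes H.phi) {segs : List (NBP.Segment V W)} {S : Set (NBP.Segment V W)}
    {A B : Finset (Fin H.m)} (hAB : Disjoint A B)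
    (hA : ∀ i ∈ A, ∀ s ∈ segs, s ∉ S → (H.tree i).root ∉ Z.segVars s)
    (hB : ∀ i ∈ B, ∀ s ∈ segs, s ∈ S → (H.tree i).root ∉ Z.segVars s)
    {M : Finset (Sym2 (Fin H.m))} {i j : Sym2 (Fin H.m) → Fin H.m}
    (hM : ∀ e ∈ M, e = s(i e, j e) ∧ i e ∈ A ∧ j e ∈ B ∧ H.underlying.Adj (i e) (j e))
    (hMd : ∀ e ∈ M, ∀ f ∈ M, e ≠ f → i e ≠ i f ∧ i e ≠ j f ∧ j e ≠ i f ∧ j e ≠ j f) :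
    ((Finset.univ.filter fun p : (Fin H.m → Fin L) × (Sym2 (Fin H.m) → Bool) =>
      Z.AcceptsAlong segs (H.assign idx p.1 p.2)).card : ℝ) ≤
      2 ^ Fintype.card (Sym2 (Fin H.m)) *
        ((L : ℝ) ^ H.m * (1 - 1 / (2 * (L : ℝ) ^ 2)) ^ M.card) := by
  -- `xy e` holds the numbers of the common leaf in the two trees: choosing both makes the pair
  -- mutual.
  have hv : ∀ e : Sym2 (Fin H.m), ∃ xy : Fin L × Fin L, e ∈ M → ∀ c : Fin H.m → Fin L,
      c (i e) = xy.1 ∧ c (j e) = xy.2 → H.Mutual idx c (i e) (j e) := by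
    intro e
    by_cases he : e ∈ M
    · obtain ⟨-, -, -, hne, v, hvi, hvj⟩ := hM e he
      exact ⟨(idx (i e) v, idx (j e) v), fun _ c hc =>
        ⟨hne, v, ⟨hvi, hc.1.symm⟩, ⟨hvj, hc.2.symm⟩⟩⟩
    · exact ⟨(⟨0, hL⟩, ⟨0, hL⟩), fun h => (he h).elim⟩
  choose xy hxy using hv
  have hfib : ∀ c : Fin H.m → Fin L,
      ((Finset.univ.filter fun b : Sym2 (Fin H.m) → Bool =>
        Z.AcceptsAlong segs (H.assign idx c b)).card : ℝ) ≤
      2 ^ Fintype.card (Sym2 (Fin H.m)) *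
        ∏ e ∈ M, (if c (i e) = (xy e).1 ∧ c (j e) = (xy e).2 then (1 / 2 : ℝ) else 1) := by
    intro c
    set Mc := M.filter fun e => c (i e) = (xy e).1 ∧ c (j e) = (xy e).2 with hMc
    have hcard := card_mul_two_pow_le
      (Finset.univ.filter fun b : Sym2 (Fin H.m) → Bool =>
        Z.AcceptsAlong segs (H.assign idx c b)) Mc (by
        intro b hb b' hb' hbb
        have hb := (Finset.mem_filter.1 hb).2
        have hb' := (Finset.mem_filter.1 hb').2
        have hout : ∀ k l, k ∉ A → k ∉ B → b s(k, l) = b' s(k, l) := by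
          intro k l hkA hkB
          refine hbb _ fun hmem => ?_
          have he := (Finset.mem_filter.1 hmem).1
          obtain ⟨h1, h2, h3, -⟩ := hM _ he
          have hk : k ∈ s(i s(k, l), j s(k, l)) := h1 ▸ Sym2.mem_mk_left k l
          rcases Sym2.mem_iff.1 hk with hk | hk
          · exact hkA (hk ▸ h2)
          · exact hkB (hk ▸ h3)
        by_contra hne
        obtain ⟨e, he⟩ := Function.ne_iff.1 hne
        have heM : e ∈ Mc := by
          by_contra h
          exact he (hbb e h)
        obtain ⟨heM, hec⟩ := Finset.mem_filter.1 heM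
        obtain ⟨h1, h2, h3, -⟩ := hM e heM
        have hmut := hxy e heM c hec
        -- `b₁` makes the root in `B` false and `b₂` the one in `A`. Stating this for arbitrary
        -- `b₁`, `b₂` lets `b` and `b'` take either role.
        have hsep : ∀ b₁ b₂ : Sym2 (Fin H.m) → Bool,
            Z.AcceptsAlong segs (H.assign idx c b₁) → Z.AcceptsAlong segs (H.assign idx c b₂) →
            (∀ k l, k ∉ A → k ∉ B → b₁ s(k, l) = b₂ s(k, l)) →
            b₁ e = decide (i e < j e) → b₂ e ≠ decide (i e < j e) → False := by
          intro b₁ b₂ ha₁ ha₂ h12 hb₁ hb₂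
          refine not_acceptsAlong_of_separated hZ hAB hA hB h12 h2 h3 hmut ?_ ?_ ha₁ ha₂
          · rwa [hmut.trueAt_root_iff hidx, ← h1]
          · rw [hmut.symm.trueAt_root_iff hidx, Sym2.eq_swap, ← h1, hb₁, decide_eq_decide]
            rcases lt_or_gt_of_ne hmut.1 with h | h
            · simp [h, h.not_gt]
            · simp [h, h.not_gt]
        by_cases hbe : b e = decide (i e < j e)
        · exact hsep b b' hb hb' hout hbe (fun h => he (hbe.trans h.symm))
        · refine hsep b' b hb' hb (fun k l hk hl => (hout k l hk hl).symm) ?_ hbe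
          revert he hbe
          cases b e <;> cases b' e <;> cases decide (i e < j e) <;> simp)
    have hprod : ∏ e ∈ M, (if c (i e) = (xy e).1 ∧ c (j e) = (xy e).2 then (1 / 2 : ℝ) else 1) =
        (1 / 2) ^ Mc.card := by
      rw [Finset.prod_ite, Finset.prod_const, Finset.prod_const_one, mul_one]
    rw [hprod, one_div, inv_pow, ← div_eq_mul_inv, le_div_iff₀ (by positivity)]
    exact_mod_cast hcard
  have hsplit : ((Finset.univ.filter fun p : (Fin H.m → Fin L) × (Sym2 (Fin H.m) → Bool) =>
      Z.AcceptsAlong segs (H.assign idx p.1 p.2)).card : ℝ) =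
      ∑ c : Fin H.m → Fin L, ((Finset.univ.filter fun b : Sym2 (Fin H.m) → Bool =>
        Z.AcceptsAlong segs (H.assign idx c b)).card : ℝ) := by
    rw [← Nat.cast_sum]
    congr 1
    simp only [Finset.card_filter]
    rw [Fintype.sum_prod_type]
  rw [hsplit]
  refine (Finset.sum_le_sum fun c _ => hfib c).trans (le_of_eq ?_)
  rw [← Finset.mul_sum, sum_prod_half hL M i j (fun e => (xy e).1) (fun e => (xy e).2)
    (fun e he => (hM e he).2.2.2.1) hMd, Fintype.card_fin]

open Classical in
/-- Few of the assignments given by choices are accepted along segments of small load. -/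
theorem card_acceptsAlong_le_exp (hH : H.IsPseudoexpander) (hidx : H.IsNumbering idx)
    (hL : 0 < L) {Z : NBP V W E} (hZ : Z.Computes H.phi) {d t : ℕ} (hd : Z.ReadTimes d)
    (hdt : 2 * (d * t) ≤ H.m) (hm : 4 * 4 ^ d * ⌈(H.m : ℝ) ^ (0.999 : ℝ)⌉₊ ≤ H.m)
    {segs : List (NBP.Segment V W)}
    (hload : ∀ s ∈ segs, Z.load (Finset.univ.image fun i => (H.tree i).root) s ≤ t) :
    ((Finset.univ.filter fun p : (Fin H.m → Fin L) × (Sym2 (Fin H.m) → Bool) =>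
      Z.AcceptsAlong segs (H.assign idx p.1 p.2)).card : ℝ) ≤
      2 ^ Fintype.card (Sym2 (Fin H.m)) * (L : ℝ) ^ H.m *
        Real.exp (-((H.m : ℝ) ^ (0.999 : ℝ) / 3 / (2 * (L : ℝ) ^ 2))) := by
  by_cases hne : (Finset.univ.filter fun p : (Fin H.m → Fin L) × (Sym2 (Fin H.m) → Bool) =>
      Z.AcceptsAlong segs (H.assign idx p.1 p.2)) = ∅
  · rw [hne, Finset.card_empty, Nat.cast_zero]
    positivity
  obtain ⟨p, hp⟩ := Finset.nonempty_iff_ne_empty.2 hne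
  obtain ⟨hchain, Qs, hQs, -⟩ := (Finset.mem_filter.1 hp).2
  let O : Fin H.m → Finset (NBP.Segment V W) := fun i =>
    segs.toFinset.filter fun s => (H.tree i).root ∈ Z.segVars s
  obtain ⟨S, A, B, hOA, hOB, hSA, hSB⟩ := exists_splitting segs.toFinset O d t (fun i => Finset.filter_subset _ _)
    (by
      intro i
      refine le_trans ?_ (hd.countP_le hchain hQs (H.tree i).root)
      rw [List.countP_eq_length_filter]
      refine le_trans (Finset.card_le_card ?_) (List.toFinset_card_le _)
      intro s hs
      simpa [O] using hs)
    (by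
      intro s hs
      refine le_trans ?_ (hload s (List.mem_toFinset.1 hs))
      rw [NBP.load]
      refine Finset.card_le_card_of_injOn (fun i => (H.tree i).root) ?_
        (H.root_injective.injOn)
      intro i hi
      have hiO : s ∈ O i := by simpa using hi
      have hi' := (Finset.mem_filter.1 hiO).2
      simp only [Finset.coe_filter, Set.mem_ofPred_eq, Finset.mem_image, Finset.mem_univ,
        true_and]
      exact ⟨⟨i, rfl⟩, hi'⟩)
    (by rwa [Fintype.card_fin])
  rw [Fintype.card_fin] at hSA hSB
  set K := ⌈(H.m : ℝ) ^ (0.999 : ℝ)⌉₊ with hK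
  have hpos : 0 < 2 * 4 ^ d := by positivity
  -- The factor `2` pays for disjointness: a root that occurs in no segment lies in both `A` and
  -- `B`, so `K` elements of `A` are kept and removed from `B`.
  have hAc : 2 * K ≤ A.card := by
    refine Nat.le_of_mul_le_mul_left (le_trans (le_of_eq ?_) (hm.trans hSA)) hpos
    ring
  have hBc : 2 * K ≤ B.card := by
    refine Nat.le_of_mul_le_mul_left (le_trans (le_of_eq ?_) (hm.trans hSB)) hpos
    ring
  obtain ⟨A', hA'A, hA'⟩ := Finset.exists_subset_card_eq (show K ≤ A.card by omega)
  have hB' : K ≤ (B \ A').card := by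
    have := Finset.le_card_sdiff A' B
    omega
  have hdisj : Disjoint A' (B \ A') := Finset.disjoint_sdiff
  obtain ⟨M, i, j, hM, hMd, hMc⟩ := hH.exists_pseudomatching A' (B \ A') hdisj
    (by rw [hA']; exact Nat.le_ceil _)
    ((Nat.le_ceil _).trans (by exact_mod_cast hB'))
  have hmain := card_acceptsAlong_le hidx hL hZ (segs := segs)
    (S := (S : Set (NBP.Segment V W))) hdisj
    (by
      intro i hi s hs hsS hmem
      exact hsS (hOA i (hA'A hi) (Finset.mem_filter.2 ⟨List.mem_toFinset.2 hs, hmem⟩)))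
    (by
      intro i hi s hs hsS hmem
      exact Finset.disjoint_left.1 (hOB i (Finset.mem_sdiff.1 hi).1)
        (Finset.mem_filter.2 ⟨List.mem_toFinset.2 hs, hmem⟩) hsS)
    hM hMd
  refine hmain.trans ?_
  rw [← mul_assoc]
  refine mul_le_mul_of_nonneg_left ?_ (by positivity)
  have hL1 : (1 : ℝ) ≤ L := by exact_mod_cast hL
  have hq0 : (0 : ℝ) ≤ 1 - 1 / (2 * (L : ℝ) ^ 2) := by
    rw [sub_nonneg, div_le_one (by positivity)]
    nlinarith
  calc (1 - 1 / (2 * (L : ℝ) ^ 2)) ^ M.card ≤ Real.exp (-(1 / (2 * (L : ℝ) ^ 2))) ^ M.card :=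
        pow_le_pow_left₀ hq0 (Real.one_sub_le_exp_neg _) _
    _ = Real.exp (-(M.card / (2 * (L : ℝ) ^ 2))) := by
        rw [← Real.exp_nat_mul]
        congr 1
        ring
    _ ≤ _ := by
        rw [Real.exp_le_exp]
        gcongr

/-- The lower bound in terms of the number of trees and their height. -/
theorem IsPseudoexpander.exp_le [Fintype V] [Fintype W] (hH : H.IsPseudoexpander) {h : ℕ}
    (h0 : 0 < h) (hh : ∀ i v, (H.tree i).IsLeaf v → ((H.tree i).rootPath v).ncard ≤ h)
    {Z : NBP V W E} (hZ : Z.Computes H.phi) {d : ℕ} (hd : Z.ReadTimes d)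
    (hdm : 2 * (d + 1) ≤ H.m) (hm : 4 * 4 ^ d * ⌈(H.m : ℝ) ^ (0.999 : ℝ)⌉₊ ≤ H.m) :
    Real.exp ((H.m : ℝ) ^ (0.999 : ℝ) / 3 / (2 * ((2 ^ h : ℕ) : ℝ) ^ 2)) ≤
      ((Fintype.card W * (Fintype.card W * (Fintype.card V * 2 + 1 + 1)) + 1 : ℕ) : ℝ) ^
        ((2 * d + 1) ^ 2) := by
  classical
  obtain ⟨idx, hidx⟩ := H.exists_isNumbering h0 hh
  have hL : 0 < 2 ^ h := by positivity
  generalize 2 ^ h = L at *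
  set Y := Finset.univ.image fun i => (H.tree i).root with hY
  have hYc : Y.card ≤ H.m := Finset.card_image_le.trans (by simp)
  set t := H.m / (2 * (d + 1)) with ht
  have ht1 : 1 ≤ t := (Nat.one_le_div_iff (by omega)).2 hdm
  have htm : t * (2 * (d + 1)) ≤ H.m := Nat.div_mul_le_self _ _
  have htm' : H.m < 2 * (d + 1) * (t + 1) := Nat.lt_mul_div_succ _ (by omega)
  let Ω := (Fin H.m → Fin L) × (Sym2 (Fin H.m) → Bool)
  have hseg : ∀ p : Ω, ∃ segs : List (NBP.Segment V W),
      Z.AcceptsAlong segs (H.assign idx p.1 p.2) ∧ (∀ s ∈ segs, Z.load Y s ≤ t) ∧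
        segs.length ≤ (2 * d + 1) ^ 2 := by
    intro p
    obtain ⟨segs, h1, h2, k, h3, h4⟩ := hd.exists_acceptsAlong Y t
      ((hZ _).2 (satisfies_assign (c := p.1) (b := p.2) hidx))
    refine ⟨segs, h1, fun s hs => (h2 s hs).trans (max_le le_rfl ht1), h3.trans ?_⟩
    -- Then `2 * k + 1 ≤ 4 * d * (d + 1) + 1 = (2 * d + 1) ^ 2`.
    have hk : k ≤ 2 * (d + 1) * d := by
      refine Nat.le_of_mul_le_mul_right (c := H.m) ?_ (by omega)
      calc k * H.m ≤ k * (2 * (d + 1) * (t + 1)) := Nat.mul_le_mul_left _ htm'.le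
        _ = 2 * (d + 1) * (k * (t + 1)) := by ring
        _ ≤ 2 * (d + 1) * (d * H.m) :=
            Nat.mul_le_mul_left _ (h4.trans (Nat.mul_le_mul_left _ hYc))
        _ = 2 * (d + 1) * d * H.m := by ring
    nlinarith
  choose segs hacc hload hlen using hseg
  -- Lists of bounded length are encoded as functions on a fixed finite type, with `none` past the
  -- end.
  let sig : Ω → (Fin ((2 * d + 1) ^ 2) → Option (NBP.Segment V W)) := fun p k => (segs p)[(k : ℕ)]?
  have hsig : ∀ p q, sig p = sig q → segs p = segs q := by
    intro p q hpq
    apply List.ext_getElem?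
    intro k
    by_cases hk : k < (2 * d + 1) ^ 2
    · exact congrFun hpq ⟨k, hk⟩
    · rw [List.getElem?_eq_none (by have := hlen p; omega),
        List.getElem?_eq_none (by have := hlen q; omega)]
  set bound := (2 : ℝ) ^ Fintype.card (Sym2 (Fin H.m)) * (L : ℝ) ^ H.m *
    Real.exp (-((H.m : ℝ) ^ (0.999 : ℝ) / 3 / (2 * (L : ℝ) ^ 2))) with hbound
  have hfib : ∀ σ, ((Finset.univ.filter fun p => sig p = σ).card : ℝ) ≤ bound := by
    intro σ
    by_cases hne : (Finset.univ.filter fun p => sig p = σ) = ∅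
    · rw [hne, Finset.card_empty, Nat.cast_zero]
      positivity
    obtain ⟨p, hp⟩ := Finset.nonempty_iff_ne_empty.2 hne
    have hp' := (Finset.mem_filter.1 hp).2
    refine le_trans ?_ (card_acceptsAlong_le_exp hH hidx hL hZ hd (t := t) (by nlinarith) hm
      (hload p))
    norm_cast
    refine Finset.card_le_card fun q hq => ?_
    have hq' := (Finset.mem_filter.1 hq).2
    refine Finset.mem_filter.2 ⟨Finset.mem_univ _, ?_⟩
    rw [hsig p q (hp'.trans hq'.symm)]
    exact hacc q
  have htotal : ((Fintype.card Ω : ℕ) : ℝ) ≤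
      Fintype.card (Fin ((2 * d + 1) ^ 2) → Option (NBP.Segment V W)) * bound := by
    rw [← Finset.card_univ, Finset.card_eq_sum_card_fiberwise (f := sig) (t := Finset.univ)
      (by intro p _; simp), Nat.cast_sum]
    refine (Finset.sum_le_sum fun σ _ => hfib σ).trans (le_of_eq ?_)
    rw [Finset.sum_const, nsmul_eq_mul, Finset.card_univ]
  have hΩ : ((Fintype.card Ω : ℕ) : ℝ) =
      (2 : ℝ) ^ Fintype.card (Sym2 (Fin H.m)) * (L : ℝ) ^ H.m := by
    simp only [Ω, Fintype.card_prod, Fintype.card_fun, Fintype.card_fin, Fintype.card_bool]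
    push_cast
    ring
  -- There are `2 * n` literals; the `1`s in `2 * n + 1 + 1` stand for an unlabelled edge and for no
  -- prescription, the outer `1` for a position past the end.
  have hcard : Fintype.card (Fin ((2 * d + 1) ^ 2) → Option (NBP.Segment V W)) =
      (Fintype.card W * (Fintype.card W * (Fintype.card V * 2 + 1 + 1)) + 1) ^
        ((2 * d + 1) ^ 2) := by
    rw [Fintype.card_fun, Fintype.card_fin, Fintype.card_option, Fintype.card_prod,
      Fintype.card_prod, Fintype.card_option, Fintype.card_option, Fintype.card_prod,
      Fintype.card_bool]
  rw [hΩ, hbound, hcard, Real.exp_neg] at htotal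
  set x := Real.exp ((H.m : ℝ) ^ (0.999 : ℝ) / 3 / (2 * (L : ℝ) ^ 2)) with hx
  have hx0 : 0 < x := Real.exp_pos _
  set D := (2 : ℝ) ^ Fintype.card (Sym2 (Fin H.m)) * (L : ℝ) ^ H.m with hD
  have hD0 : 0 < D := by positivity
  push_cast at htotal ⊢
  rw [mul_comm D, ← mul_assoc] at htotal
  have h1 := le_of_mul_le_mul_right ((one_mul D).le.trans htotal) hD0
  rwa [← div_eq_mul_inv, le_div_iff₀ hx0, one_mul] at h1

end BTB

/-! ### Numerical estimates and the choice of the constants -/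

/-- The estimates, valid for large `x`, into which the lower bound is translated. -/
theorem exists_large_bounds : ∃ m₀ : ℕ, ∀ x : ℝ, (m₀ : ℝ) ≤ x →
    1 ≤ x ∧ Real.log x ≤ x ^ (0.01 : ℝ) ∧ 16 ≤ x ^ (0.0009 : ℝ) ∧ 34560 < x ^ (0.55 : ℝ) := by
  have h1 : ∀ᶠ x : ℝ in Filter.atTop, Real.log x ≤ x ^ (0.01 : ℝ) := by
    have := (isLittleO_log_rpow_atTop (r := 0.01) (by norm_num)).bound one_pos
    filter_upwards [this, Filter.eventually_ge_atTop 1] with x hx hx1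
    rw [one_mul, Real.norm_of_nonneg (Real.log_nonneg hx1),
      Real.norm_of_nonneg (by positivity)] at hx
    exact hx
  -- `16 = 4 * 2 * 2` collects the factors in the condition on `4 ^ d`, and `34560 = 90 * 384` those
  -- in the final comparison, where `0.55 = 0.59 - 0.04`.
  have h2 := (tendsto_rpow_atTop (y := 0.0009) (by norm_num)).eventually_ge_atTop 16
  have h3 := (tendsto_rpow_atTop (y := 0.55) (by norm_num)).eventually_gt_atTop 34560
  obtain ⟨a, ha⟩ := Filter.eventually_atTop.1
    ((Filter.eventually_ge_atTop (1 : ℝ)).and (h1.and (h2.and h3)))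
  exact ⟨⌈a⌉₊, fun x hx => ha x ((Nat.le_ceil a).trans hx)⟩

theorem logb_two_le {x : ℝ} (hx : 1 ≤ x) : Real.logb 2 x ≤ 2 * Real.log x := by
  have h2 : (0.5 : ℝ) < Real.log 2 := by linarith [Real.log_two_gt_d9]
  rw [Real.logb, div_le_iff₀ (by linarith)]
  nlinarith [Real.log_nonneg hx]

/-- The conditions on the number of repetitions. -/
theorem repetition_bounds {x : ℝ} {n d : ℕ} (hx : 1 ≤ x) (hlog : Real.log x ≤ x ^ (0.01 : ℝ))
    (h16 : 16 ≤ x ^ (0.0009 : ℝ)) (hn0 : 0 < n) (hn : (n : ℝ) ≤ 8 * x ^ 2)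
    (hd : (d : ℝ) ≤ Real.logb 2 n / 10 ^ 5) :
    (d : ℝ) ≤ x ^ (0.01 : ℝ) ∧ 2 * ((d : ℝ) + 1) ≤ x ∧
      4 * 4 ^ d * (⌈x ^ (0.999 : ℝ)⌉₊ : ℝ) ≤ x := by
  have hx0 : 0 < x := by linarith
  have hlogn : Real.logb 2 n ≤ 3 + 2 * Real.logb 2 x := by
    have hn0' : (0 : ℝ) < n := by exact_mod_cast hn0
    calc Real.logb 2 n ≤ Real.logb 2 (8 * x ^ 2) :=
          Real.logb_le_logb_of_le (by norm_num) hn0' hn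
      _ = 3 + 2 * Real.logb 2 x := by
          rw [Real.logb_mul (by norm_num) (by positivity), Real.logb_pow,
            show (8 : ℝ) = 2 ^ (3 : ℕ) by norm_num, Real.logb_pow,
            Real.logb_self_eq_one (by norm_num)]
          norm_num
  have hp1 : 1 ≤ x ^ (0.01 : ℝ) := Real.one_le_rpow hx (by norm_num)
  have hd1 : (d : ℝ) ≤ x ^ (0.01 : ℝ) := by
    have := logb_two_le hx
    have h5 : Real.logb 2 n / 10 ^ 5 ≤ (3 + 4 * x ^ (0.01 : ℝ)) / 10 ^ 5 := by
      gcongr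
      linarith
    refine (hd.trans h5).trans ?_
    rw [div_le_iff₀ (by norm_num)]
    linarith
  refine ⟨hd1, ?_, ?_⟩
  · have h1 : x ^ (0.0009 : ℝ) * x ^ (0.01 : ℝ) ≤ x := by
      rw [← Real.rpow_add hx0]
      conv_rhs => rw [← Real.rpow_one x]
      exact Real.rpow_le_rpow_of_exponent_le hx (by norm_num)
    nlinarith
  -- `4 ^ d = 2 ^ (2 * d)` and `2 * d ≤ (6 + 4 * logb 2 x) / 10 ^ 5`, whence the exponent `0.00004`;
  -- the factor `2` absorbs the constant term.
  · have h4 : (4 : ℝ) ^ d ≤ 2 * x ^ (0.00004 : ℝ) := by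
      have he : (4 : ℝ) ^ d = (2 : ℝ) ^ (2 * (d : ℝ)) := by
        rw [Real.rpow_mul (by norm_num), Real.rpow_natCast]
        norm_num
      rw [he]
      calc (2 : ℝ) ^ (2 * (d : ℝ)) ≤ (2 : ℝ) ^ (1 + Real.logb 2 x * (0.00004 : ℝ)) := by
            apply Real.rpow_le_rpow_of_exponent_le (by norm_num)
            have h5 : Real.logb 2 n / 10 ^ 5 ≤ (3 + 2 * Real.logb 2 x) / 10 ^ 5 := by gcongr
            have := hd.trans h5
            norm_num at this ⊢
            linarith
        _ = 2 * x ^ (0.00004 : ℝ) := by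
            rw [Real.rpow_add (by norm_num), Real.rpow_one, Real.rpow_mul (by norm_num),
              Real.rpow_logb (by norm_num) (by norm_num) hx0]
    have hc : (⌈x ^ (0.999 : ℝ)⌉₊ : ℝ) ≤ 2 * x ^ (0.999 : ℝ) := by
      have h1 : 1 ≤ x ^ (0.999 : ℝ) := Real.one_le_rpow hx (by norm_num)
      have := (Nat.ceil_lt_add_one (zero_le_one.trans h1)).le
      linarith
    calc 4 * 4 ^ d * (⌈x ^ (0.999 : ℝ)⌉₊ : ℝ)
        ≤ 4 * (2 * x ^ (0.00004 : ℝ)) * (2 * x ^ (0.999 : ℝ)) := by gcongr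
      _ = 16 * (x ^ (0.00004 : ℝ) * x ^ (0.999 : ℝ)) := by ring
      _ ≤ x ^ (0.0009 : ℝ) * (x ^ (0.00004 : ℝ) * x ^ (0.999 : ℝ)) := by gcongr
      _ ≤ x := by
          rw [← Real.rpow_add hx0, ← Real.rpow_add hx0]
          conv_rhs => rw [← Real.rpow_one x]
          exact Real.rpow_le_rpow_of_exponent_le hx (by norm_num)

/-- Programs of size less than `exp (n ^ 0.01)` have too few signatures. -/
theorem signatures_lt {x w : ℝ} {n d : ℕ} (hx : 1 ≤ x) (hlog : Real.log x ≤ x ^ (0.01 : ℝ))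
    (h55 : 34560 < x ^ (0.55 : ℝ)) (hn : (n : ℝ) ≤ 8 * x ^ 2) (hd : (d : ℝ) ≤ x ^ (0.01 : ℝ))
    (hw0 : 0 ≤ w) (hw : w ≤ Real.exp ((n : ℝ) ^ (0.01 : ℝ))) :
    (w * (w * (n * 2 + 1 + 1)) + 1) ^ ((2 * d + 1) ^ 2) < Real.exp (x ^ (0.59 : ℝ) / 384) := by
  have hx0 : 0 < x := by linarith
  set y := x ^ (0.01 : ℝ) with hy
  have hy1 : 1 ≤ y := Real.one_le_rpow hx (by norm_num)
  have hyy : y ≤ y ^ 2 := by nlinarith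
  have hy2 : y ^ 2 = x ^ (0.02 : ℝ) := by
    rw [hy, ← Real.rpow_natCast, ← Real.rpow_mul hx0.le]
    norm_num
  have hnb : (n : ℝ) ^ (0.01 : ℝ) ≤ 2 * y ^ 2 := by
    calc (n : ℝ) ^ (0.01 : ℝ) ≤ (8 * x ^ 2) ^ (0.01 : ℝ) :=
          Real.rpow_le_rpow (by positivity) hn (by norm_num)
      _ = 8 ^ (0.01 : ℝ) * y ^ 2 := by
          rw [Real.mul_rpow (by norm_num) (by positivity), hy2, ← Real.rpow_natCast x 2,
            ← Real.rpow_mul hx0.le]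
          norm_num
      _ ≤ 2 * y ^ 2 := by
          gcongr
          calc (8 : ℝ) ^ (0.01 : ℝ) = 2 ^ (0.03 : ℝ) := by
                rw [show (8 : ℝ) = 2 ^ (3 : ℝ) by norm_num, ← Real.rpow_mul (by norm_num)]
                norm_num
            _ ≤ 2 ^ (1 : ℝ) := Real.rpow_le_rpow_of_exponent_le (by norm_num) (by norm_num)
            _ = 2 := Real.rpow_one 2
  have hw' : w ≤ Real.exp (2 * y ^ 2) := hw.trans (Real.exp_le_exp.2 hnb)
  -- `19` arises from `16 * x ^ 2 + 3 ≤ 19 * x ^ 2` in the bound for the base.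
  have h19 : (19 : ℝ) ≤ Real.exp 4 := by
    have h1 : (2.7 : ℝ) ≤ Real.exp 1 := by linarith [Real.exp_one_gt_d9]
    calc (19 : ℝ) ≤ 2.7 ^ 4 := by norm_num
      _ ≤ Real.exp 1 ^ 4 := by gcongr
      _ = Real.exp 4 := by rw [← Real.exp_nat_mul]; norm_num
  have hx2 : x ^ 2 ≤ Real.exp (2 * y) := by
    calc x ^ 2 = Real.exp (2 * Real.log x) := by
          rw [two_mul, Real.exp_add, Real.exp_log hx0, pow_two]
      _ ≤ _ := Real.exp_le_exp.2 (by linarith)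
  have hbase : w * (w * (n * 2 + 1 + 1)) + 1 ≤ Real.exp (10 * y ^ 2) := by
    have hE : 1 ≤ Real.exp (2 * y ^ 2) := Real.one_le_exp (by positivity)
    calc w * (w * (n * 2 + 1 + 1)) + 1
        ≤ Real.exp (2 * y ^ 2) * (Real.exp (2 * y ^ 2) * (8 * x ^ 2 * 2 + 1 + 1)) +
            Real.exp (2 * y ^ 2) * (Real.exp (2 * y ^ 2) * 1) := by
          gcongr
          nlinarith
      _ = Real.exp (2 * y ^ 2) * Real.exp (2 * y ^ 2) * (16 * x ^ 2 + 3) := by ring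
      _ ≤ Real.exp (2 * y ^ 2) * Real.exp (2 * y ^ 2) * (19 * x ^ 2) := by
          gcongr
          nlinarith
      _ ≤ Real.exp (2 * y ^ 2) * Real.exp (2 * y ^ 2) * (Real.exp 4 * Real.exp (2 * y)) := by
          gcongr
      _ = Real.exp (4 * y ^ 2 + 4 + 2 * y) := by
          rw [← Real.exp_add, ← Real.exp_add, ← Real.exp_add]
          congr 1
          ring
      _ ≤ Real.exp (10 * y ^ 2) := Real.exp_le_exp.2 (by nlinarith)
  calc (w * (w * (n * 2 + 1 + 1)) + 1) ^ ((2 * d + 1) ^ 2)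
      ≤ Real.exp (10 * y ^ 2) ^ ((2 * d + 1) ^ 2) := by gcongr
    _ = Real.exp ((2 * (d : ℝ) + 1) ^ 2 * (10 * y ^ 2)) := by
        rw [← Real.exp_nat_mul]
        push_cast
        rfl
    _ ≤ Real.exp ((3 * y) ^ 2 * (10 * y ^ 2)) := by
        rw [Real.exp_le_exp]
        gcongr
        linarith
    _ = Real.exp (90 * x ^ (0.04 : ℝ)) := by
        have : y ^ 2 * y ^ 2 = x ^ (0.04 : ℝ) := by
          rw [hy2, ← Real.rpow_add hx0]
          norm_num
        rw [← this]
        congr 1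
        ring
    _ < Real.exp (x ^ (0.59 : ℝ) / 384) := by
        rw [Real.exp_lt_exp, lt_div_iff₀ (by norm_num)]
        have h59 : x ^ (0.59 : ℝ) = x ^ (0.55 : ℝ) * x ^ (0.04 : ℝ) := by
          rw [← Real.rpow_add hx0]
          norm_num
        have h04 : 0 < x ^ (0.04 : ℝ) := by positivity
        rw [h59]
        nlinarith

theorem mainTheorem1 :
    ∃ α β : ℝ, 1 < α ∧ 0 < β ∧ β < 1 ∧ ∃ N : ℕ,
      ∀ (V : Type*) [Fintype V] (H : BTB V), H.IsPseudoexpander → N ≤ Fintype.card V →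
      ∀ (W E : Type*) [Fintype W] [Fintype E] (Z : NBP V W E) (d : ℕ),
        (d : ℝ) ≤ Real.logb 2 (Fintype.card V : ℝ) / 10 ^ 5 →
        Z.ReadTimes d → Z.Computes H.phi →
        α ^ ((Fintype.card V : ℝ) ^ β) ≤ (Z.size : ℝ) := by
  obtain ⟨m₀, hm₀⟩ := exists_large_bounds
  -- Since `n ≤ 8 * m ^ 2`, this `N` forces `m₀ ≤ m`, which makes all the estimates available.
  refine ⟨Real.exp 1, 0.01, ?_, by norm_num, by norm_num, 8 * m₀ ^ 2 + 1, ?_⟩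
  · exact Real.one_lt_exp_iff.2 one_pos
  intro V _ H hH hN W E _ _ Z d hd hread hcomp
  rw [Real.exp_one_rpow]
  set n := Fintype.card V with hn
  have hV : Nonempty V := Fintype.card_pos_iff.1 (by omega)
  have hm0 : 0 < H.m := by
    obtain ⟨i, -⟩ := H.verts_cover hV.some
    exact i.pos
  have hm1 : (1 : ℝ) ≤ H.m := by exact_mod_cast hm0
  have hmpos : (0 : ℝ) < H.m := by linarith
  have hlog0 : 0 ≤ Real.logb 2 (H.m : ℝ) := Real.logb_nonneg (by norm_num) hm1
  set h := ⌊Real.logb 2 (H.m : ℝ) / 4.9 + 3⌋₊ with hh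
  have h0 : 0 < h := by
    have : 0 ≤ Real.logb 2 (H.m : ℝ) / 4.9 := by positivity
    exact Nat.floor_pos.2 (by linarith)
  have hheight : ∀ i v, (H.tree i).IsLeaf v → ((H.tree i).rootPath v).ncard ≤ h :=
    fun i v hv => Nat.le_floor (hH.small_height i v hv)
  have h2h : ((2 ^ h : ℕ) : ℝ) ≤ 8 * (H.m : ℝ) ^ (1 / 4.9 : ℝ) := by
    push_cast
    rw [← Real.rpow_natCast]
    calc (2 : ℝ) ^ (h : ℝ) ≤ (2 : ℝ) ^ (Real.logb 2 (H.m : ℝ) * (1 / 4.9) + 3) := by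
          apply Real.rpow_le_rpow_of_exponent_le (by norm_num)
          rw [mul_one_div]
          exact Nat.floor_le (by positivity)
      _ = 8 * (H.m : ℝ) ^ (1 / 4.9 : ℝ) := by
          rw [Real.rpow_add (by norm_num), Real.rpow_mul (by norm_num),
            Real.rpow_logb (by norm_num) (by norm_num) hmpos]
          norm_num
          ring
  have hnm : (n : ℝ) ≤ 8 * (H.m : ℝ) ^ 2 := by
    calc (n : ℝ) ≤ (H.m : ℝ) * ((2 ^ h : ℕ) : ℝ) := by exact_mod_cast H.card_le h0 hheight
      _ ≤ (H.m : ℝ) * (8 * (H.m : ℝ) ^ (1 : ℝ)) := by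
          gcongr
          refine h2h.trans ?_
          gcongr
          norm_num
      _ = 8 * (H.m : ℝ) ^ 2 := by rw [Real.rpow_one]; ring
  have hmm : (m₀ : ℝ) ≤ H.m := by
    have hnm' : n ≤ 8 * H.m ^ 2 := by exact_mod_cast hnm
    have : m₀ ≤ H.m := by
      by_contra hlt
      have := Nat.pow_le_pow_left (not_le.1 hlt).le 2
      omega
    exact_mod_cast this
  obtain ⟨-, hlog, h16, h55⟩ := hm₀ _ hmm
  obtain ⟨hd1, hd2, hd3⟩ := repetition_bounds hm1 hlog h16 (by omega) hnm hd
  have hexp := hH.exp_le h0 hheight hcomp hread (by exact_mod_cast hd2) (by exact_mod_cast hd3)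
  by_contra hlt
  have hsig := signatures_lt hm1 hlog h55 hnm hd1 (Nat.cast_nonneg (Fintype.card W))
    (not_le.1 hlt).le
  push_cast at hexp hsig
  refine absurd (hexp.trans_lt hsig) (not_lt.2 (Real.exp_le_exp.2 ?_))
  -- `2 / 4.9 < 0.409 = 0.999 - 0.59`, and `384 = 3 * 2 * 64`.
  have hsq : ((2 : ℝ) ^ h) ^ 2 ≤ 64 * (H.m : ℝ) ^ (0.409 : ℝ) := by
    push_cast at h2h
    calc ((2 : ℝ) ^ h) ^ 2 ≤ (8 * (H.m : ℝ) ^ (1 / 4.9 : ℝ)) ^ 2 := by gcongr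
      _ = 64 * (H.m : ℝ) ^ (2 / 4.9 : ℝ) := by
          rw [mul_pow, ← Real.rpow_natCast ((H.m : ℝ) ^ (1 / 4.9 : ℝ)) 2,
            ← Real.rpow_mul hmpos.le]
          norm_num
      _ ≤ 64 * (H.m : ℝ) ^ (0.409 : ℝ) := by
          gcongr
          norm_num
  rw [div_div, le_div_iff₀ (by positivity)]
  calc (H.m : ℝ) ^ (0.59 : ℝ) / 384 * (3 * (2 * ((2 : ℝ) ^ h) ^ 2))
      ≤ (H.m : ℝ) ^ (0.59 : ℝ) / 384 * (3 * (2 * (64 * (H.m : ℝ) ^ (0.409 : ℝ)))) := by gcongr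
    _ = (H.m : ℝ) ^ (0.59 : ℝ) * (H.m : ℝ) ^ (0.409 : ℝ) := by ring
    _ = (H.m : ℝ) ^ (0.999 : ℝ) := by
        rw [← Real.rpow_add hmpos]
        norm_num
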